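/- Let $N\ge 1$, $1<p<2$, $0<s<1$, $\gamma\in[0,1)$, $\alpha\in[0,1)$ and $1\le q<\infty$. Write $B_r$ for the open ball of radius $r$ centred at $0$ in $\mathbb{R}^N$, $J_p(t)=|t|^{p-2}t$, and $\delta_h^2u(x)=u(x+2h)-2u(x+h)+u(x)$. Let $W^{s,p}(\Omega)$ be the space of all $u\in L^p(\Omega)$ with $\iint_{\Omega\times\Omega}\frac{|u(x)-u(y)|^p}{|x-y|^{N+sp}}\,dx\,dy<\infty$; $W^{s,p}_{\rm loc}(\Omega)$ is the space of functions belonging to $W^{s,p}(\Omega')$ for every open $\Omega'\Subset\Omega$; and $L^{p-1}_{sp}(\mathbb{R}^N)$ is the space of all $u\in L^{p-1}_{\rm loc}(\mathbb{R}^N)$ with $\int_{\mathbb{R}^N}\frac{|u(x)|^{p-1}}{1+|x|^{N+sp}}\,dx<\infty$. A function $u\in W^{s,p}_{\rm loc}(B_2)\cap L^{p-1}_{sp}(\mathbb{R}^N)$ is a local weak solution of $(-\Delta_p)^su=0$ in $B_2$ if $$\int_{\mathbb{R}^N}\int_{\mathbb{R}^N}\frac{J_p(u(x)-u(y))\,(\varphi(x)-\varphi(y))}{|x-y|^{N+sp}}\,dx\,dy=0$$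 for every $\varphi\in W^{s,p}(B_2)$ with compact support in $B_2$ (extended by zero). **Proposition.** There is a positive constant $C=C(N,s,p,q,h_0,\alpha,\gamma)$, defined for $0<h_0<\frac1{10}$, which for fixed $N,s,p,q,\alpha,\gamma$ is nonincreasing in $h_0$ and tends to $+\infty$ as $h_0\searrow0$, such that the following holds. Let $0<h_0<\frac1{10}$ and $4h_0<R\le 1-5h_0$, and let $u\in W^{s,p}_{\rm loc}(B_2)\cap L^{p-1}_{sp}(\mathbb{R}^N)$ be a local weak solution of $(-\Delta_p)^su=0$ in $B_2$ with $$\|u\|_{L^\infty(B_1)}\le 1,\qquad \int_{\mathbb{R}^N\setminus B_1}\frac{|u(y)|^{p-1}}{|y|^{N+sp}}\,dy\le 1,\qquad [u]_{C^\gamma(B_1)}=\sup_{x\ne y\in B_1}\frac{|u(x)-u(y)|}{|x-y|^\gamma}\le 1,$$ and $$\sup_{0<|h|<h_0}\left\|\frac{\delta_h^2u}{|h|^\alpha}\right\|_{L^q(B_{R+4h_0})}<+\infty.$$ Then $$\sup_{0<|h|<h_0}\left\|\frac{\delta_h^2u}{|h|^{\frac{sp-\gamma(p-2)+\alpha q}{q+1}}}\right\|_{L^{q+1}(B_{R-4h_0})}^{q+1}\le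 C\left(\sup_{0<|h|<h_0}\left\|\frac{\delta_h^2u}{|h|^\alpha}\right\|_{L^q(B_{R+4h_0})}^{q}+1\right).$$ -/

import Mathlib

open MeasureTheory Filter Topology
open scoped ENNReal

noncomputable section

namespace FracPLaplace

/-- The monotone power `J_p(t) = |t|^{p-2} t`, with value `0` at `t = 0`. -/
def J (p t : ℝ) : ℝ := |t| ^ (p - 2) * t

/-- The first difference `δ_h ψ(x) = ψ(x + h) - ψ(x)`. -/
def diff {N : ℕ} (h : EuclideanSpace ℝ (Fin N)) (ψ : EuclideanSpace ℝ (Fin N) → ℝ) :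
    EuclideanSpace ℝ (Fin N) → ℝ :=
  fun x => ψ (x + h) - ψ x

/-- The second difference `δ_h² ψ = δ_h (δ_h ψ)`. -/
def diff2 {N : ℕ} (h : EuclideanSpace ℝ (Fin N)) (ψ : EuclideanSpace ℝ (Fin N) → ℝ) :
    EuclideanSpace ℝ (Fin N) → ℝ :=
  diff h (diff h ψ)

/-- The Hölder seminorm `[u]_{C^δ(Ω)}`, as an extended nonnegative number. -/
def holderSeminorm {N : ℕ} (δ : ℝ) (Ω : Set (EuclideanSpace ℝ (Fin N)))
    (u : EuclideanSpace ℝ (Fin N) → ℝ) : ℝ≥0∞ :=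
  ⨆ (x ∈ Ω) (y ∈ Ω) (_ : x ≠ y), ENNReal.ofReal (|u x - u y| / ‖x - y‖ ^ δ)

/-- The Gagliardo seminorm `[ψ]_{W^{β,q}(Ω)}`. -/
def gagliardoSeminorm {N : ℕ} (β q : ℝ) (Ω : Set (EuclideanSpace ℝ (Fin N)))
    (ψ : EuclideanSpace ℝ (Fin N) → ℝ) : ℝ≥0∞ :=
  (∫⁻ x in Ω, ∫⁻ y in Ω,
    ENNReal.ofReal (|ψ x - ψ y| ^ q / ‖x - y‖ ^ ((N : ℝ) + β * q))) ^ (1 / q)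

/-- `ψ ∈ W^{β,q}(Ω)`. -/
def MemW {N : ℕ} (β q : ℝ) (Ω : Set (EuclideanSpace ℝ (Fin N)))
    (ψ : EuclideanSpace ℝ (Fin N) → ℝ) : Prop :=
  MemLp ψ (ENNReal.ofReal q) (volume.restrict Ω) ∧ gagliardoSeminorm β q Ω ψ < ⊤

/-- `ψ ∈ W^{β,q}_loc(Ω)`: `ψ ∈ W^{β,q}(Ω')` for all open `Ω'` compactly contained in `Ω`. -/
def MemWLoc {N : ℕ} (β q : ℝ) (Ω : Set (EuclideanSpace ℝ (Fin N)))
    (ψ : EuclideanSpace ℝ (Fin N) → ℝ) : Prop :=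
  ∀ Ω' : Set (EuclideanSpace ℝ (Fin N)), IsOpen Ω' → IsCompact (closure Ω') →
    closure Ω' ⊆ Ω → MemW β q Ω' ψ

/-- The tail space `L^q_a(ℝ^N)`. -/
def MemTailSpace {N : ℕ} (q a : ℝ) (u : EuclideanSpace ℝ (Fin N) → ℝ) : Prop :=
  (∀ K : Set (EuclideanSpace ℝ (Fin N)), IsCompact K →
    MemLp u (ENNReal.ofReal q) (volume.restrict K)) ∧
  ∫⁻ x, ENNReal.ofReal (|u x| ^ q / (1 + ‖x‖ ^ ((N : ℝ) + a))) < ⊤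

/-- `Tail_{q,a}(u; x₀, R)`. -/
def tail {N : ℕ} (q a : ℝ) (u : EuclideanSpace ℝ (Fin N) → ℝ)
    (x₀ : EuclideanSpace ℝ (Fin N)) (R : ℝ) : ℝ≥0∞ :=
  (ENNReal.ofReal (R ^ a) * ∫⁻ x in (Metric.ball x₀ R)ᶜ,
    ENNReal.ofReal (|u x| ^ q / ‖x - x₀‖ ^ ((N : ℝ) + a))) ^ (1 / q)

/-- The integrand `J_p(u(x) - u(y)) (φ(x) - φ(y)) / |x - y|^{N + s p}` of the weak formulation,
as a function of the pair `z = (x, y)`. -/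
def weakIntegrand {N : ℕ} (s p : ℝ) (u φ : EuclideanSpace ℝ (Fin N) → ℝ)
    (z : EuclideanSpace ℝ (Fin N) × EuclideanSpace ℝ (Fin N)) : ℝ :=
  J p (u z.1 - u z.2) * (φ z.1 - φ z.2) / ‖z.1 - z.2‖ ^ ((N : ℝ) + s * p)

/-- `u ∈ W^{s,p}_loc(Ω) ∩ L^{p-1}_{sp}(ℝ^N)` is a local weak solution of `(-Δ_p)^s u = 0` in `Ω`:
the weak formulation holds for every compactly supported `φ ∈ W^{s,p}(Ω)` (extended by zero).
For such `u` and `φ` the double integral always converges absolutely (by Hölder's inequality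
near the support of `φ` and by the tail condition far from it); the integrability clause only
records that the integral in the definition is a genuine one. -/
def IsLocalWeakSolution {N : ℕ} (s p : ℝ) (Ω : Set (EuclideanSpace ℝ (Fin N)))
    (u : EuclideanSpace ℝ (Fin N) → ℝ) : Prop :=
  MemWLoc s p Ω u ∧ MemTailSpace (p - 1) (s * p) u ∧
  ∀ φ : EuclideanSpace ℝ (Fin N) → ℝ, MemW s p Ω φ → HasCompactSupport φ → tsupport φ ⊆ Ω →
    Integrable (weakIntegrand s p u φ) (volume.prod volume) ∧
    ∫ z, weakIntegrand s p u φ z ∂(volume.prod volume) = 0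

/-- `sup_{0 < |h| < h₀} ‖ δ_h² u / |h|^β ‖_{L^q(B_r)}`, where `B_r` is the ball centred at `0`. -/
def secondDiffSup {N : ℕ} (β q h₀ r : ℝ) (u : EuclideanSpace ℝ (Fin N) → ℝ) : ℝ≥0∞ :=
  ⨆ (h : EuclideanSpace ℝ (Fin N)) (_ : 0 < ‖h‖ ∧ ‖h‖ < h₀),
    eLpNorm (fun x => diff2 h u x / ‖h‖ ^ β) (ENNReal.ofReal q)
      (volume.restrict (Metric.ball 0 r))

end FracPLaplace

end

/-! The equation is differenced by `h` and tested with `J_{q+1}(w) η²`, where `w = δ_h u` and `η` is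
a cutoff. The same `h` is then used to difference `w` once more.

Since `p < 2`, the derivative of `J p` decreases in `|t|`, so monotonicity of `J p` on `[-M, M]`
costs a factor `M ^ (p - 2)`. The Hölder bound allows `M = |x - y| ^ γ`, which turns the kernel `|x
- y| ^ (-N - s p)` into `|x - y| ^ (-N - σ)` with `σ = s p - γ (p - 2)`. The product of the
increments of `J p` and `J (q + 1)` therefore controls the energy of `w` with power `q + 1` and
kernel exponent `N + σ`. Cutoff errors and tail errors are both linear in `∫ |w| ^ q`, because `u`
is bounded near the support of `η`. This is `energy_diff_le`; its pointwise core is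
`le_J_sub_mul_cutoff`.

Two real-variable facts finish the argument. By `lintegral_increment_le`, an increment by `h` gains
`|h| ^ σ` from that energy, and `δ_h w = δ_h² u`. By `lintegral_diff_rpow_le`, first differences
inherit the rate `|h| ^ α` from second differences, because `α < 1`. The combined rate is `|h| ^ (σ
+ α q)`, the `(q + 1)`-st power of the asserted one. The constant is a negative power of `h₀`,
coming from the cutoff width `h₀` and from the comparison of differences. -/

namespace FracPLaplace

/-! ### Scalar inequalities for the monotone powers -/

/-- A symmetric and odd relation on the reals holds as soon as it holds on two quadrants. -/
theorem rel_of_quadrants {P : ℝ → ℝ → Prop} (swap : ∀ a b, P a b → P b a)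
    (neg : ∀ a b, P a b → P (-a) (-b)) (same : ∀ a b, 0 ≤ b → b ≤ a → P a b)
    (opp : ∀ a b, 0 ≤ a → 0 ≤ b → P a (-b)) (a b : ℝ) : P a b := by
  rcases le_total 0 a with ha | ha <;> rcases le_total 0 b with hb | hb
  · rcases le_total b a with h | h
    · exact same a b hb h
    · exact swap _ _ (same b a ha h)
  · simpa using opp a (-b) ha (by linarith)
  · exact swap _ _ (by simpa using opp b (-a) hb (by linarith))
  · rcases le_total b a with h | h
    · have := swap _ _ (neg _ _ (same (-b) (-a) (by linarith) (by linarith)))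
      simpa using this
    · have := neg _ _ (same (-a) (-b) (by linarith) (by linarith))
      simpa using this

theorem J_neg (p t : ℝ) : J p (-t) = -J p t := by simp [J]

theorem J_zero (p : ℝ) : J p 0 = 0 := by simp [J]

theorem J_of_nonneg {p t : ℝ} (hp : 1 < p) (ht : 0 ≤ t) : J p t = t ^ (p - 1) := by
  rcases ht.eq_or_lt with rfl | ht
  · rw [J_zero, Real.zero_rpow (by linarith)]
  · rw [J, abs_of_pos ht]
    nth_rewrite 2 [← Real.rpow_one t]
    rw [← Real.rpow_add ht]
    congr 1; ring

theorem abs_J {p : ℝ} (hp : 1 < p) (t : ℝ) : |J p t| = |t| ^ (p - 1) := by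
  rcases le_total 0 t with ht | ht
  · rw [J_of_nonneg hp ht, abs_of_nonneg ht, abs_of_nonneg (by positivity)]
  · have : J p t = -J p (-t) := by rw [J_neg]; ring
    rw [this, abs_neg, J_of_nonneg hp (by linarith), abs_of_nonpos ht,
      abs_of_nonneg (Real.rpow_nonneg (by linarith) _)]

theorem measurable_J (p : ℝ) : Measurable (J p) := by
  unfold J; fun_prop

theorem add_rpow_le {r x y : ℝ} (hr : 0 ≤ r) (hx : 0 ≤ x) (hy : 0 ≤ y) :
    (x + y) ^ r ≤ 2 ^ r * (x ^ r + y ^ r) := by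
  have h : ∀ x y : ℝ, 0 ≤ x → 0 ≤ y → x ≤ y → (x + y) ^ r ≤ 2 ^ r * (x ^ r + y ^ r) := by
    intro x y hx hy hxy
    calc (x + y) ^ r ≤ (2 * y) ^ r := Real.rpow_le_rpow (by positivity) (by linarith) hr
      _ = 2 ^ r * y ^ r := Real.mul_rpow (by norm_num) hy
      _ ≤ _ := by
        have := Real.rpow_nonneg hx r
        gcongr; linarith
  rcases le_total x y with hxy | hxy
  · exact h x y hx hy hxy
  · rw [add_comm x, add_comm (x ^ r)]; exact h y x hy hx hxy

theorem add_rpow_le_add {r x y : ℝ} (hr : 0 ≤ r) (hr1 : r ≤ 1) (hx : 0 ≤ x) (hy : 0 ≤ y) :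
    (x + y) ^ r ≤ x ^ r + y ^ r := by
  lift x to NNReal using hx
  lift y to NNReal using hy
  exact_mod_cast NNReal.rpow_add_le_add_rpow x y hr hr1

/-- For equal signs this is subadditivity of `t ^ (p - 1)`, valid since `p - 1 ≤ 1`. The factor 2 is
spent on opposite signs. -/
theorem abs_J_sub_le {p : ℝ} (hp : 1 < p) (hp2 : p < 2) (a b : ℝ) :
    |J p a - J p b| ≤ 2 * |a - b| ^ (p - 1) := by
  refine rel_of_quadrants (P := fun a b => |J p a - J p b| ≤ 2 * |a - b| ^ (p - 1))
    ?_ ?_ ?_ ?_ a b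
  · intro a b h; rwa [abs_sub_comm, abs_sub_comm b]
  · intro a b h
    rw [J_neg, J_neg]
    rw [show -J p a - -J p b = -(J p a - J p b) by ring, show -a - -b = -(a - b) by ring,
      abs_neg, abs_neg]
    exact h
  · intro a b hb hab
    have h1 := add_rpow_le_add (r := p - 1) (by linarith) (by linarith) hb (sub_nonneg.2 hab)
    rw [add_sub_cancel] at h1
    have h2 : b ^ (p - 1) ≤ a ^ (p - 1) := Real.rpow_le_rpow hb hab (by linarith)
    have h3 := Real.rpow_nonneg (sub_nonneg.2 hab) (p - 1)
    rw [J_of_nonneg hp hb, J_of_nonneg hp (hb.trans hab), abs_of_nonneg (by linarith),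
      abs_of_nonneg (sub_nonneg.2 hab)]
    linarith
  · intro a b ha hb
    have h1 : a ^ (p - 1) ≤ (a + b) ^ (p - 1) :=
      Real.rpow_le_rpow ha (by linarith) (by linarith)
    have h2 : b ^ (p - 1) ≤ (a + b) ^ (p - 1) :=
      Real.rpow_le_rpow hb (by linarith) (by linarith)
    have h3 := Real.rpow_nonneg ha (p - 1)
    have h4 := Real.rpow_nonneg hb (p - 1)
    rw [J_neg, J_of_nonneg hp hb, J_of_nonneg hp ha, sub_neg_eq_add, sub_neg_eq_add,
      abs_of_nonneg (by linarith), abs_of_nonneg (by linarith)]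
    linarith

theorem rpow_sub_one_mul {x r : ℝ} (hx : 0 < x) : x ^ (r - 1) * x = x ^ r := by
  nth_rewrite 2 [← Real.rpow_one x]
  rw [← Real.rpow_add hx]; congr 1; ring

theorem rpow_sub_one_mul' {x r : ℝ} (hx : 0 ≤ x) (hr : 0 < r) : x ^ (r - 1) * x = x ^ r := by
  rcases hx.eq_or_lt with rfl | hx
  · rw [mul_zero, Real.zero_rpow hr.ne']
  · exact rpow_sub_one_mul hx

/-- The derivative `(p - 1) |t| ^ (p - 2)` decreases in `|t|`, so on `[-M, M]` it is smallest at the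
endpoints. -/
theorem le_J_sub_mul_sub {p M a b : ℝ} (hp : 1 < p) (hp2 : p < 2) (hM : 0 < M)
    (ha : |a| ≤ M) (hb : |b| ≤ M) :
    (p - 1) * M ^ (p - 2) * (a - b) ^ 2 ≤ (J p a - J p b) * (a - b) := by
  have key : ∀ a b : ℝ, |a| ≤ M → |b| ≤ M →
      (p - 1) * M ^ (p - 2) * (a - b) ^ 2 ≤ (J p a - J p b) * (a - b) := by
    refine rel_of_quadrants (P := fun a b => |a| ≤ M → |b| ≤ M →
      (p - 1) * M ^ (p - 2) * (a - b) ^ 2 ≤ (J p a - J p b) * (a - b)) ?_ ?_ ?_ ?_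
    · intro a b h h1 h2
      have := h h2 h1
      nlinarith
    · intro a b h h1 h2
      have := h (by simpa using h1) (by simpa using h2)
      rw [J_neg, J_neg]
      nlinarith
    · intro a b hb hab h1 h2
      rcases (hb.trans hab).eq_or_lt with h0 | h0
      · have : b = 0 := by linarith
        simp [this, ← h0]
      rw [abs_of_pos h0] at h1
      rw [J_of_nonneg hp hb, J_of_nonneg hp h0.le]
      -- Bernoulli's inequality at `b / a`: the concave power lies below its tangent at 1. It
      -- replaces the mean value theorem and allows `b = 0`.
      have hB := rpow_one_add_le_one_add_mul_self (s := b / a - 1)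
        (by have : 0 ≤ b / a := by positivity
            linarith) (p := p - 1) (by linarith) (by linarith)
      rw [add_sub_cancel, Real.div_rpow hb h0.le, div_le_iff₀ (by positivity)] at hB
      have e1 : a ^ (p - 2) * a = a ^ (p - 1) := by
        have := rpow_sub_one_mul (r := p - 1) h0
        rwa [show p - 1 - 1 = p - 2 by ring] at this
      have e2 : (b / a - 1) * a ^ (p - 1) = a ^ (p - 2) * (b - a) := by
        rw [← e1]; field_simp
      have h3 : M ^ (p - 2) ≤ a ^ (p - 2) := Real.rpow_le_rpow_of_nonpos h0 h1 (by linarith)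
      have h4 : (p - 1) * a ^ (p - 2) * (a - b) ≤ a ^ (p - 1) - b ^ (p - 1) := by
        have : (1 + (p - 1) * (b / a - 1)) * a ^ (p - 1)
          = a ^ (p - 1) + (p - 1) * ((b / a - 1) * a ^ (p - 1)) := by ring
        rw [this, e2] at hB
        linarith
      calc _ = (p - 1) * M ^ (p - 2) * (a - b) * (a - b) := by ring
        _ ≤ (p - 1) * a ^ (p - 2) * (a - b) * (a - b) := by
          have := sub_nonneg.2 hab
          have := sub_nonneg.2 hp.le
          gcongr
        _ ≤ _ := by
          have := sub_nonneg.2 hab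
          gcongr
    · intro a b ha hb h1 h2
      rw [abs_neg, abs_of_nonneg hb] at h2
      rw [abs_of_nonneg ha] at h1
      have h : ∀ x : ℝ, 0 ≤ x → x ≤ M → M ^ (p - 2) * x ≤ x ^ (p - 1) := by
        intro x hx hxM
        rcases hx.eq_or_lt with rfl | hx
        · rw [mul_zero, Real.zero_rpow (by linarith)]
        · have := rpow_sub_one_mul (r := p - 1) hx
          rw [show p - 1 - 1 = p - 2 by ring] at this
          rw [← this]
          exact mul_le_mul_of_nonneg_right (Real.rpow_le_rpow_of_nonpos hx hxM (by linarith)) hx.le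
      have e1 := h a ha h1
      have e2 := h b hb h2
      rw [J_neg, J_of_nonneg hp hb, J_of_nonneg hp ha, sub_neg_eq_add, sub_neg_eq_add]
      have h3 : 0 < M ^ (p - 2) := by positivity
      calc (p - 1) * M ^ (p - 2) * (a + b) ^ 2 ≤ 1 * M ^ (p - 2) * (a + b) ^ 2 := by
            gcongr; linarith
        _ = (M ^ (p - 2) * a + M ^ (p - 2) * b) * (a + b) := by ring
        _ ≤ _ := by gcongr
  exact key a b ha hb

/-- The weight is `(|a| + |b|) ^ (q - 1)` and not the weaker `|a - b| ^ (q - 1)`: the cross term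
produced by the cutoff carries powers of `|a| + |b|` and is absorbed only by this form. -/
theorem le_J_add_one_sub_mul_sub {q : ℝ} (hq : 1 ≤ q) (a b : ℝ) :
    2 ^ (-q) * ((a - b) ^ 2 * (|a| + |b|) ^ (q - 1)) ≤ (J (q + 1) a - J (q + 1) b) * (a - b) := by
  have hq1 : 1 < q + 1 := by linarith
  have half : ∀ m M : ℝ, 0 ≤ m → m ≤ 2 * M → 2 ^ (-q) * m ^ (q - 1) ≤ M ^ (q - 1) := by
    intro m M hm hM
    have h1 : (2 : ℝ) ^ (-q) ≤ 2 ^ (-(q - 1)) :=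
      Real.rpow_le_rpow_of_exponent_le (by norm_num) (by linarith)
    calc _ ≤ 2 ^ (-(q - 1)) * (2 * M) ^ (q - 1) := by
          gcongr
      _ = _ := by
          rw [Real.mul_rpow (by norm_num) (by linarith), ← mul_assoc, ← Real.rpow_add (by norm_num)]
          simp
  refine rel_of_quadrants (P := fun a b => 2 ^ (-q) * ((a - b) ^ 2 * (|a| + |b|) ^ (q - 1)) ≤
    (J (q + 1) a - J (q + 1) b) * (a - b)) ?_ ?_ ?_ ?_ a b
  · intro a b h
    rw [add_comm |b|]
    nlinarith
  · intro a b h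
    rw [J_neg, J_neg, abs_neg, abs_neg]
    rw [show (-a - -b) ^ 2 = (a - b) ^ 2 by ring]
    nlinarith
  · intro a b hb hab
    have ha := hb.trans hab
    rw [J_of_nonneg hq1 hb, J_of_nonneg hq1 ha, abs_of_nonneg ha, abs_of_nonneg hb,
      add_sub_cancel_right]
    have h1 := half (a + b) a (by linarith) (by linarith)
    have h2 : b ^ q ≤ a ^ (q - 1) * b := by
      rw [← rpow_sub_one_mul' hb (by linarith)]
      gcongr
    have h3 := rpow_sub_one_mul' ha (r := q) (by linarith)
    have h4 := sub_nonneg.2 hab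
    calc _ = (2 ^ (-q) * (a + b) ^ (q - 1)) * (a - b) * (a - b) := by ring
      _ ≤ a ^ (q - 1) * (a - b) * (a - b) := by gcongr
      _ ≤ _ := by gcongr; linarith
  · intro a b ha hb
    rw [J_neg, J_of_nonneg hq1 hb, J_of_nonneg hq1 ha, abs_neg, abs_of_nonneg ha,
      abs_of_nonneg hb, add_sub_cancel_right, sub_neg_eq_add, sub_neg_eq_add]
    have h5 := Real.rpow_nonneg ha q
    have h6 := Real.rpow_nonneg hb q
    have h0 : 2 ^ (-q) * (a + b) ^ q ≤ a ^ q + b ^ q := by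
      have := add_rpow_le (r := q) (by linarith) ha hb
      rw [Real.rpow_neg (by norm_num), inv_mul_le_iff₀ (by positivity)]
      exact this
    have h3 := rpow_sub_one_mul' (add_nonneg ha hb) (r := q) (by linarith)
    calc _ = 2 ^ (-q) * ((a + b) ^ (q - 1) * (a + b)) * (a + b) := by ring
      _ ≤ _ := by
        rw [h3]; gcongr

/-- Local Lipschitz continuity, from Bernoulli's inequality for the convex power `q ≥ 1`. It serves
only to show that the test function has finite energy. -/
theorem abs_J_add_one_sub_le {q K a b : ℝ} (hq : 1 ≤ q) (ha : |a| ≤ K) (hb : |b| ≤ K) :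
    |J (q + 1) a - J (q + 1) b| ≤ q * K ^ (q - 1) * |a - b| := by
  have hq1 : 1 < q + 1 := by linarith
  have key : ∀ a b : ℝ, |a| ≤ K → |b| ≤ K →
      |J (q + 1) a - J (q + 1) b| ≤ q * K ^ (q - 1) * |a - b| := by
    refine rel_of_quadrants (P := fun a b => |a| ≤ K → |b| ≤ K →
      |J (q + 1) a - J (q + 1) b| ≤ q * K ^ (q - 1) * |a - b|) ?_ ?_ ?_ ?_
    · intro a b h h1 h2
      rw [abs_sub_comm, abs_sub_comm b]; exact h h2 h1
    · intro a b h h1 h2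
      rw [J_neg, J_neg, show -J (q + 1) a - -J (q + 1) b = -(J (q + 1) a - J (q + 1) b) by ring,
        show -a - -b = -(a - b) by ring, abs_neg, abs_neg]
      exact h (by simpa using h1) (by simpa using h2)
    · intro a b hb hab h1 h2
      rcases (hb.trans hab).eq_or_lt with h0 | h0
      · have : b = 0 := by linarith
        simp [this, ← h0]
      rw [abs_of_pos h0] at h1
      have hd := sub_nonneg.2 hab
      have hB := one_add_mul_self_le_rpow_one_add (s := b / a - 1)
        (by have : 0 ≤ b / a := by positivity
            linarith) (p := q) hq
      rw [add_sub_cancel, Real.div_rpow hb h0.le, le_div_iff₀ (by positivity)] at hB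
      have e1 := rpow_sub_one_mul (r := q) h0
      have e2 : (b / a - 1) * a ^ q = a ^ (q - 1) * (b - a) := by
        rw [← e1]; field_simp
      have hm : b ^ q ≤ a ^ q := Real.rpow_le_rpow hb hab (by linarith)
      rw [J_of_nonneg hq1 hb, J_of_nonneg hq1 h0.le, add_sub_cancel_right,
        abs_of_nonneg (by linarith), abs_of_nonneg hd]
      have : (1 + q * (b / a - 1)) * a ^ q = a ^ q + q * ((b / a - 1) * a ^ q) := by ring
      rw [this, e2] at hB
      calc _ ≤ q * a ^ (q - 1) * (a - b) := by linarith
        _ ≤ _ := by gcongr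
    · intro a b ha hb h1 h2
      rw [abs_neg, abs_of_nonneg hb] at h2
      rw [abs_of_nonneg ha] at h1
      have h : ∀ x : ℝ, 0 ≤ x → x ≤ K → x ^ q ≤ K ^ (q - 1) * x := by
        intro x hx hxK
        rw [← rpow_sub_one_mul' hx (by linarith)]
        gcongr
      have h3 := h a ha h1
      have h4 := h b hb h2
      have h5 : 0 ≤ K ^ (q - 1) := Real.rpow_nonneg (ha.trans h1) _
      rw [J_neg, J_of_nonneg hq1 hb, J_of_nonneg hq1 ha, add_sub_cancel_right, sub_neg_eq_add,
        sub_neg_eq_add, abs_of_nonneg (by positivity), abs_of_nonneg (by positivity)]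
      calc _ ≤ 1 * K ^ (q - 1) * (a + b) := by linarith
        _ ≤ _ := by gcongr
  exact key a b ha hb

set_option maxHeartbeats 800000 in
/-- The pointwise inequality behind the energy estimate for the differenced equation. -/
theorem le_J_sub_mul_cutoff {p q M a b w₁ w₂ e₁ e₂ : ℝ} (hp : 1 < p) (hp2 : p < 2) (hq : 1 ≤ q)
    (hM : 0 < M) (ha : |a| ≤ M) (hb : |b| ≤ M) (hw : a - b = w₁ - w₂)
    (h₁ : 0 ≤ e₁) (h₁' : e₁ ≤ 1) (h₂ : 0 ≤ e₂) (h₂' : e₂ ≤ 1) :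
    (p - 1) * 2 ^ (-q) / 4 * (M ^ (p - 2) * |w₁ - w₂| ^ (q + 1) * (e₁ ^ 2 + e₂ ^ 2)) ≤
      (J p a - J p b) * (J (q + 1) w₁ * e₁ ^ 2 - J (q + 1) w₂ * e₂ ^ 2) +
        4 * (2 ^ (-q) / 8) ^ (1 - p) * ((|w₁| + |w₂|) ^ (q + p - 1) * |e₁ - e₂| ^ p) := by
  have hq1 : 1 < q + 1 := by linarith
  set m := |w₁| + |w₂| with hm
  set k : ℝ := 2 ^ (-q) with hk
  have hk0 : 0 < k := by positivity
  set d := |w₁ - w₂| with hd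
  have hd0 : 0 ≤ d := abs_nonneg _
  have hm0 : 0 ≤ m := by positivity
  have hdm : d ≤ m := abs_sub _ _
  set D := |J p a - J p b| with hD
  have hD0 : 0 ≤ D := abs_nonneg _
  have hJ := le_J_sub_mul_sub hp hp2 hM ha hb
  have hG := le_J_add_one_sub_mul_sub hq w₁ w₂
  rw [hw] at hJ
  rw [← hm] at hG
  have hDu : D ≤ 2 * d ^ (p - 1) := by
    have := abs_J_sub_le hp hp2 a b
    rwa [hw] at this
  have hM2 : 0 < M ^ (p - 2) := by positivity
  have hp1 : 0 < p - 1 := by linarith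
  set X := J p a - J p b with hX
  set Y := J (q + 1) w₁ - J (q + 1) w₂ with hY
  set Z := J (q + 1) w₁ + J (q + 1) w₂ with hZ
  set t := w₁ - w₂ with ht
  have hdt : d ^ 2 = t ^ 2 := sq_abs t
  have hDd : D * d = X * t := by
    rw [hD, hd, ← abs_mul]
    exact abs_of_nonneg (le_trans (by positivity) hJ)
  -- The two monotonicity bounds control `X * t` and `Y * t`; their product is compared after
  -- multiplying by `t ^ 2`, which is then cancelled.
  have hXY : k * (D * d * m ^ (q - 1)) ≤ X * Y := by
    rcases eq_or_ne t 0 with h0 | h0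
    · have hXt : X = 0 := by
        have hab : a = b := by linarith
        simp [hX, hab]
      rw [hDd, h0, hXt]; simp
    · have ht2 : 0 < t ^ 2 := by positivity
      have h1 : k * (D * d * m ^ (q - 1)) * t ^ 2 ≤ X * Y * t ^ 2 := by
        rw [hDd]
        have hXt : 0 ≤ X * t := le_trans (by positivity) hJ
        calc _ = X * t * (k * (t ^ 2 * m ^ (q - 1))) := by ring
          _ ≤ X * t * (Y * t) := by gcongr
          _ = _ := by ring
      exact le_of_mul_le_mul_right h1 ht2
  have hZm : |Z| ≤ 2 * m ^ q := by
    have hb1 : |J (q + 1) w₁| ≤ m ^ q := by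
      rw [abs_J hq1, add_sub_cancel_right]
      exact Real.rpow_le_rpow (abs_nonneg _) (by rw [hm]; linarith [abs_nonneg w₂]) (by linarith)
    have hb2 : |J (q + 1) w₂| ≤ m ^ q := by
      rw [abs_J hq1, add_sub_cancel_right]
      exact Real.rpow_le_rpow (abs_nonneg _) (by rw [hm]; linarith [abs_nonneg w₁]) (by linarith)
    calc |Z| ≤ _ := abs_add_le _ _
      _ ≤ _ := by linarith
  set η := e₁ + e₂ with hη
  set δ := |e₁ - e₂| with hδ
  have hη0 : 0 ≤ η := by positivity
  have hη2 : η ≤ 2 := by linarith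
  have hδ0 : 0 ≤ δ := abs_nonneg _
  have hηsq : η ^ 2 ≤ 2 * (e₁ ^ 2 + e₂ ^ 2) := by nlinarith [sq_nonneg (e₁ - e₂)]
  set s := e₁ ^ 2 + e₂ ^ 2 with hs
  have hs0 : 0 ≤ s := by positivity
  -- Symmetrised discrete product rule: a coercive term, plus a cross term containing the increment
  -- of the cutoff.
  have hsplit : X * (J (q + 1) w₁ * e₁ ^ 2 - J (q + 1) w₂ * e₂ ^ 2) =
      X * Y * s / 2 + X * Z * (e₁ - e₂) * η / 2 := by
    rw [hY, hZ, hs, hη]; ring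
  have hcross : -(D * m ^ q * η * δ) ≤ X * Z * (e₁ - e₂) * η / 2 := by
    have h1 : |X * Z * (e₁ - e₂) * η / 2| ≤ D * m ^ q * η * δ := by
      rw [abs_div, abs_mul, abs_mul, abs_mul, abs_of_nonneg hη0, ← hD, ← hδ]
      rw [abs_of_pos (by norm_num : (0:ℝ) < 2), div_le_iff₀ (by norm_num)]
      calc D * |Z| * δ * η ≤ D * (2 * m ^ q) * δ * η := by gcongr
        _ = _ := by ring
    exact neg_le_of_abs_le h1
  have hmq : m ^ (q - 1) * m = m ^ q := rpow_sub_one_mul' hm0 (by linarith)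
  have hbad : D * m ^ q * η * δ ≤ k * (D * d * m ^ (q - 1)) * s / 4 +
      4 * (k / 8) ^ (1 - p) * (m ^ (q + p - 1) * δ ^ p) := by
    have hmp : 0 ≤ m ^ (q + p - 1) := Real.rpow_nonneg hm0 _
    have hδp : 0 ≤ δ ^ p := Real.rpow_nonneg hδ0 _
    have hκ : 0 < (k / 8) ^ (1 - p) := by positivity
    -- Either the cutoff increment is relatively small and the cross term is absorbed by a quarter
    -- of the coercive term, or `d * η` is at most a multiple of `m * δ`. In the second case `D ≤ 2
    -- d ^ (p - 1)` leaves only powers of `m` and `δ`.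
    rcases le_total (m * δ) (k / 8 * (d * η)) with h | h
    · have hm1 : 0 ≤ m ^ (q - 1) := Real.rpow_nonneg hm0 _
      have : D * m ^ q * η * δ ≤ k * (D * d * m ^ (q - 1)) * s / 4 := by
        calc D * m ^ q * η * δ = D * m ^ (q - 1) * η * (m * δ) := by rw [← hmq]; ring
          _ ≤ D * m ^ (q - 1) * η * (k / 8 * (d * η)) := by gcongr
          _ = k / 8 * (D * d * m ^ (q - 1)) * η ^ 2 := by ring
          _ ≤ k / 8 * (D * d * m ^ (q - 1)) * (2 * s) := by gcongr
          _ = _ := by ring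
      have : 0 ≤ 4 * (k / 8) ^ (1 - p) * (m ^ (q + p - 1) * δ ^ p) := by positivity
      linarith
    · have h1 : d * η ≤ (k / 8)⁻¹ * (m * δ) := by
        rw [le_inv_mul_iff₀ (by positivity)]; exact h
      -- Since `η ≤ 2`, surplus powers of `η` are traded for a constant, so that `d` and `η` appear
      -- with the same exponent.
      have h2 : η ≤ 2 * η ^ (p - 1) := by
        have e1 : η ^ (2 - p) * η ^ (p - 1) = η := by
          rw [← Real.rpow_add_of_nonneg hη0 (by linarith) (by linarith)]
          norm_num
        calc η = η ^ (2 - p) * η ^ (p - 1) := e1.symm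
          _ ≤ 2 * η ^ (p - 1) := by
            gcongr
            calc η ^ (2 - p) ≤ 2 ^ (2 - p) := Real.rpow_le_rpow hη0 hη2 (by linarith)
              _ ≤ 2 ^ (1 : ℝ) := Real.rpow_le_rpow_of_exponent_le (by norm_num) (by linarith)
              _ = 2 := by norm_num
      have h3 : D * m ^ q * η * δ ≤ 4 * (k / 8) ^ (1 - p) * (m ^ (q + p - 1) * δ ^ p) := by
        have hmq0 : 0 ≤ m ^ q := Real.rpow_nonneg hm0 _
        calc D * m ^ q * η * δ ≤ (2 * d ^ (p - 1)) * m ^ q * (2 * η ^ (p - 1)) * δ := by gcongr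
          _ = 4 * (d * η) ^ (p - 1) * m ^ q * δ := by rw [Real.mul_rpow hd0 hη0]; ring
          _ ≤ 4 * ((k / 8)⁻¹ * (m * δ)) ^ (p - 1) * m ^ q * δ := by gcongr
          _ = 4 * (k / 8) ^ (1 - p) * ((m ^ (p - 1) * m ^ q) * (δ ^ (p - 1) * δ)) := by
            rw [Real.mul_rpow (by positivity) (by positivity), Real.mul_rpow hm0 hδ0,
              Real.inv_rpow (by positivity), ← Real.rpow_neg (by positivity), neg_sub]
            ring
          _ = _ := by
            rw [rpow_sub_one_mul' hδ0 (by linarith),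
              ← Real.rpow_add_of_nonneg hm0 (by linarith) (by linarith)]
            congr 3; ring
      have : 0 ≤ k * (D * d * m ^ (q - 1)) * s / 4 := by
        have hm1 : 0 ≤ m ^ (q - 1) := Real.rpow_nonneg hm0 _
        positivity
      linarith
  have hgood : (p - 1) * k / 4 * (M ^ (p - 2) * d ^ (q + 1) * s) ≤
      k * (D * d * m ^ (q - 1)) * s / 4 := by
    have e1 : d ^ (q + 1) = d ^ 2 * d ^ (q - 1) := by
      rw [← Real.rpow_two, ← Real.rpow_add_of_nonneg hd0 (by norm_num) (by linarith)]
      congr 1; ring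
    rw [hDd, e1, hdt]
    calc _ = k / 4 * s * ((p - 1) * M ^ (p - 2) * t ^ 2 * d ^ (q - 1)) := by ring
      _ ≤ k / 4 * s * ((X * t) * m ^ (q - 1)) := by
        have : d ^ (q - 1) ≤ m ^ (q - 1) := Real.rpow_le_rpow hd0 hdm (by linarith)
        have : 0 ≤ d ^ (q - 1) := Real.rpow_nonneg hd0 _
        have hXt : 0 ≤ X * t := le_trans (by positivity) hJ
        gcongr
      _ = _ := by ring
  have hXYs : k * (D * d * m ^ (q - 1)) * s ≤ X * Y * s := by gcongr
  rw [hsplit]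
  linarith

/-! ### Kernel integrals, translations and measurability -/

/-- Euclidean space of dimension `N`. -/
abbrev Euc (N : ℕ) := EuclideanSpace ℝ (Fin N)

variable {N : ℕ}

theorem lintegral_ball_norm_rpow_lt_top (hN : 1 ≤ N) {e : ℝ} (he : 0 < e) (T : ℝ) :
    ∫⁻ z in Metric.ball (0 : Euc N) T, ENNReal.ofReal (‖z‖ ^ (e - N)) < ⊤ := by
  have h := integrableOn_ball_of_norm_le_rpow (E := Euc N) (F := ℝ) (μ := volume)
    (f := fun z => ‖z‖ ^ (e - N)) (C := 1) (α := N - e) (r := T) (by simpa using hN)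
    (by simpa using he) (Filter.Eventually.of_forall fun z => by
      rw [one_mul, neg_sub, Real.norm_of_nonneg (by positivity)])
    ((measurable_norm.pow_const (e - (N : ℝ))).aestronglyMeasurable)
  have := h.lintegral_lt_top
  exact this

theorem lintegral_compl_ball_norm_rpow_lt_top {e : ℝ} (he : 0 < e) :
    ∫⁻ z in (Metric.ball (0 : Euc N) 1)ᶜ, ENNReal.ofReal (1 / ‖z‖ ^ ((N : ℝ) + e)) < ⊤ := by
  have h := finite_integral_one_add_norm (E := Euc N) (μ := volume) (r := N + e)
    (by simpa using he)
  have hle : ∫⁻ z in (Metric.ball (0 : Euc N) 1)ᶜ, ENNReal.ofReal (1 / ‖z‖ ^ ((N : ℝ) + e)) ≤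
      ∫⁻ z in (Metric.ball (0 : Euc N) 1)ᶜ,
        ENNReal.ofReal (2 ^ ((N : ℝ) + e)) * ENNReal.ofReal ((1 + ‖z‖) ^ (-((N : ℝ) + e))) := by
    refine setLIntegral_mono' Metric.isOpen_ball.measurableSet.compl fun z hz => ?_
    have hz1 : 1 ≤ ‖z‖ := by simpa using hz
    rw [← ENNReal.ofReal_mul (by positivity)]
    refine ENNReal.ofReal_le_ofReal ?_
    rw [Real.rpow_neg (by positivity), ← div_eq_mul_inv, div_le_div_iff₀ (by positivity)
      (by positivity), one_mul, ← Real.mul_rpow (by norm_num) (by positivity)]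
    exact Real.rpow_le_rpow (by positivity) (by linarith) (by positivity)
  refine hle.trans_lt ?_
  rw [lintegral_const_mul' _ _ ENNReal.ofReal_ne_top]
  exact ENNReal.mul_lt_top ENNReal.ofReal_lt_top ((setLIntegral_le_lintegral _ _).trans_lt h)

/-- Away from `x₀` the kernel centred at `x₀` is comparable to the one centred at the origin: `d ≤
1/2` and `2 d ≤ ‖x₀ - z‖` give `d ‖z‖ ≤ ‖x₀ - z‖`. Inside the unit ball the kernel is simply
bounded. -/
theorem lintegral_far_le {a d : ℝ} (ha : 0 ≤ a) (hd : 0 < d) (hd1 : d ≤ 1 / 2) {x₀ : Euc N}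
    (hx : ‖x₀‖ ≤ 1) (g : Euc N → ℝ≥0∞) :
    ∫⁻ z in {z | 2 * d ≤ ‖x₀ - z‖}, g z * ENNReal.ofReal (1 / ‖x₀ - z‖ ^ a) ≤
      ENNReal.ofReal (d ^ (-a)) * ((∫⁻ z in Metric.ball 0 1, g z) +
        ∫⁻ z in (Metric.ball 0 1)ᶜ, g z * ENNReal.ofReal (1 / ‖z‖ ^ a)) := by
  have hm : MeasurableSet {z : Euc N | 2 * d ≤ ‖x₀ - z‖} :=
    measurableSet_le (by fun_prop) (by fun_prop)
  have hb : MeasurableSet (Metric.ball (0 : Euc N) 1) := Metric.isOpen_ball.measurableSet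
  rw [← lintegral_indicator hm, ← lintegral_add_compl _ hb, mul_add,
    ← lintegral_const_mul' _ _ ENNReal.ofReal_ne_top,
    ← lintegral_const_mul' _ _ ENNReal.ofReal_ne_top]
  refine add_le_add (setLIntegral_mono' hb fun z _ => ?_)
    (setLIntegral_mono' hb.compl fun z hz => ?_)
  · refine Set.indicator_apply_le' (fun hz => ?_) (fun _ => zero_le)
    have hz : 2 * d ≤ ‖x₀ - z‖ := hz
    rw [mul_comm]
    gcongr
    rw [Real.rpow_neg hd.le, ← one_div]
    gcongr
    linarith
  · refine Set.indicator_apply_le' (fun hz2 => ?_) (fun _ => zero_le)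
    have hz1 : 1 ≤ ‖z‖ := by simpa using hz
    have hz2 : 2 * d ≤ ‖x₀ - z‖ := hz2
    rw [mul_left_comm, ← ENNReal.ofReal_mul (by positivity)]
    gcongr
    have h1 : ‖z‖ * d ≤ ‖x₀ - z‖ := by
      have h3 : ‖z‖ ≤ ‖x₀‖ + ‖x₀ - z‖ := by
        calc ‖z‖ = ‖x₀ - (x₀ - z)‖ := by simp
          _ ≤ _ := norm_sub_le _ _
      nlinarith
    have : 0 < ‖z‖ := by linarith
    rw [Real.rpow_neg hd.le, mul_one_div, ← one_div, div_div, mul_comm,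
      ← Real.mul_rpow this.le hd.le]
    gcongr

theorem setLIntegral_comp_add_right_le {s t : Set (Euc N)} (hs : MeasurableSet s)
    (ht : MeasurableSet t) (h : Euc N) (hst : ∀ x ∈ s, x + h ∈ t) (f : Euc N → ℝ≥0∞) :
    ∫⁻ x in s, f (x + h) ≤ ∫⁻ x in t, f x := by
  rw [← lintegral_indicator hs, ← lintegral_indicator ht,
    ← lintegral_add_right_eq_self (t.indicator f) h]
  refine lintegral_mono fun x => ?_
  refine Set.indicator_apply_le' (fun hx => ?_) (fun _ => zero_le)
  rw [Set.indicator_of_mem (hst x hx)]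

theorem aemeasurable_comp_fst {w : Euc N → ℝ} (hw : AEMeasurable w) {s t : Set (Euc N)} :
    AEMeasurable (fun z : Euc N × Euc N => w z.1)
      ((volume.restrict s).prod (volume.restrict t)) :=
  hw.restrict.comp_quasiMeasurePreserving Measure.quasiMeasurePreserving_fst

theorem aemeasurable_comp_snd {w : Euc N → ℝ} (hw : AEMeasurable w) {s t : Set (Euc N)} :
    AEMeasurable (fun z : Euc N × Euc N => w z.2)
      ((volume.restrict s).prod (volume.restrict t)) :=
  hw.restrict.comp_quasiMeasurePreserving Measure.quasiMeasurePreserving_snd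

theorem aemeasurable_gagliardo {w : Euc N → ℝ} (hw : AEMeasurable w) (Q a : ℝ)
    {s t : Set (Euc N)} :
    AEMeasurable (fun z : Euc N × Euc N =>
      ENNReal.ofReal (|w z.1 - w z.2| ^ Q / ‖z.1 - z.2‖ ^ a))
      ((volume.restrict s).prod (volume.restrict t)) := by
  have h1 : AEMeasurable (fun z : Euc N × Euc N => |w z.1 - w z.2| ^ Q)
      ((volume.restrict s).prod (volume.restrict t)) :=
    (by fun_prop : Measurable fun t : ℝ => |t| ^ Q).comp_aemeasurable
      ((aemeasurable_comp_fst hw).sub (aemeasurable_comp_snd hw))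
  have h2 : Measurable fun z : Euc N × Euc N => ‖z.1 - z.2‖ ^ a :=
    (by fun_prop : Measurable fun z : Euc N × Euc N => ‖z.1 - z.2‖).pow_const a
  exact (h1.div h2.aemeasurable).ennreal_ofReal

/-! ### Increments against Gagliardo energy -/

/-- Translation estimate: an increment is controlled by the Gagliardo energy. -/
theorem lintegral_increment_le {w : Euc N → ℝ} (hw : AEMeasurable w) {Q σ : ℝ} (hQ : 0 < Q)
    (hσ : 0 ≤ N + σ) {h : Euc N} (hh : h ≠ 0) {r ρ : ℝ} (hρ : r + ‖h‖ ≤ ρ) :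
    ∫⁻ x in Metric.ball 0 r, ENNReal.ofReal (|w (x + h) - w x| ^ Q) ≤
      ENNReal.ofReal (2 ^ Q * 2 * 2 ^ N / (volume (Metric.ball (0 : Euc N) 1)).toReal * ‖h‖ ^ σ) *
        ∫⁻ x in Metric.ball 0 ρ, ∫⁻ y in Metric.ball 0 ρ,
          ENNReal.ofReal (|w x - w y| ^ Q / ‖x - y‖ ^ ((N : ℝ) + σ)) := by
  set f : Euc N → Euc N → ℝ≥0∞ := fun x y =>
    ENNReal.ofReal (|w x - w y| ^ Q / ‖x - y‖ ^ ((N : ℝ) + σ)) with hf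
  set V := (volume (Metric.ball (0 : Euc N) 1)).toReal with hV
  have hVtop : volume (Metric.ball (0 : Euc N) 1) ≠ ⊤ := measure_ball_lt_top.ne
  have hV0 : 0 < V := ENNReal.toReal_pos (Metric.measure_ball_pos _ _ one_pos).ne' hVtop
  have hh0 : 0 < ‖h‖ := norm_pos_iff.2 hh
  have : Nontrivial (Euc N) := ⟨⟨h, 0, hh⟩⟩
  set B := Metric.ball (0 : Euc N) ρ with hB
  have hBm : MeasurableSet B := Metric.isOpen_ball.measurableSet
  have hrm : MeasurableSet (Metric.ball (0 : Euc N) r) := Metric.isOpen_ball.measurableSet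
  set c := ENNReal.ofReal (2 ^ Q * ‖h‖ ^ ((N : ℝ) + σ)) with hc
  set v := (‖h‖ / 2) ^ N * V with hv
  have hv0 : 0 < v := by positivity
  have near : ∀ x y, ‖x - y‖ ≤ ‖h‖ → |w x - w y| ^ Q ≤
      ‖h‖ ^ ((N : ℝ) + σ) * (|w x - w y| ^ Q / ‖x - y‖ ^ ((N : ℝ) + σ)) := by
    intro x y hxy
    rcases eq_or_ne x y with rfl | hne
    · simp [Real.zero_rpow hQ.ne']
    · have h0 : 0 < ‖x - y‖ := norm_pos_iff.2 (sub_ne_zero.2 hne)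
      have h1 : ‖x - y‖ ^ ((N : ℝ) + σ) ≤ ‖h‖ ^ ((N : ℝ) + σ) :=
        Real.rpow_le_rpow h0.le hxy hσ
      rw [mul_div_assoc', le_div_iff₀ (by positivity), mul_comm]
      gcongr
  have hpt : ∀ x ∈ Metric.ball (0 : Euc N) r, ENNReal.ofReal (|w (x + h) - w x| ^ Q) ≤
      ENNReal.ofReal (1 / v) * c * ((∫⁻ y in B, f (x + h) y) + ∫⁻ y in B, f x y) := by
    intro x hx
    have hxr : ‖x‖ < r := by simpa using hx
    -- Every `y` in the ball of radius `‖h‖ / 2` about this midpoint is within `‖h‖` of both `x` and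
    -- `x + h`. Averaging the triangle inequality over such `y` brings in the kernel.
    set b := x + (1 / 2 : ℝ) • h with hb
    have hsub : Metric.ball b (‖h‖ / 2) ⊆ B := by
      intro y hy
      have h1 : ‖y - b‖ < ‖h‖ / 2 := by simpa [dist_eq_norm] using hy
      have h2 : ‖b‖ ≤ ‖x‖ + ‖h‖ / 2 := by
        refine (norm_add_le _ _).trans ?_
        rw [norm_smul]; norm_num; linarith
      have h3 : ‖y‖ ≤ ‖y - b‖ + ‖b‖ := by
        simpa using norm_add_le (y - b) b
      rw [hB, mem_ball_zero_iff]; linarith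
    have hvol : volume (Metric.ball b (‖h‖ / 2)) = ENNReal.ofReal v := by
      rw [Measure.addHaar_ball _ _ (by positivity), hv, ENNReal.ofReal_mul (by positivity), hV,
        ENNReal.ofReal_toReal hVtop]
      simp
    have hmeas : AEMeasurable (fun y => f (x + h) y) (volume.restrict B) := by
      have := hw.restrict (s := B)
      fun_prop
    have h1 : ENNReal.ofReal (|w (x + h) - w x| ^ Q) * ENNReal.ofReal v ≤
        c * ((∫⁻ y in B, f (x + h) y) + ∫⁻ y in B, f x y) := by
      rw [← lintegral_add_left' hmeas, ← lintegral_const_mul' _ _ ENNReal.ofReal_ne_top, ← hvol,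
        ← setLIntegral_const]
      refine (setLIntegral_mono' Metric.isOpen_ball.measurableSet fun y hy => ?_).trans
        (lintegral_mono_set hsub)
      have h1 : ‖y - b‖ < ‖h‖ / 2 := by simpa [dist_eq_norm] using hy
      have h12 : ‖(1 / 2 : ℝ) • h‖ = ‖h‖ / 2 := by rw [norm_smul]; norm_num; ring
      have e1 : ‖x + h - y‖ ≤ ‖h‖ := by
        have : x + h - y = (1 / 2 : ℝ) • h - (y - b) := by
          rw [hb]; module
        rw [this]; refine (norm_sub_le _ _).trans ?_
        linarith
      have e2 : ‖x - y‖ ≤ ‖h‖ := by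
        have : x - y = -((1 / 2 : ℝ) • h + (y - b)) := by
          rw [hb]; module
        rw [this, norm_neg]; refine (norm_add_le _ _).trans ?_
        linarith
      simp only [hf]
      rw [← ENNReal.ofReal_add (by positivity) (by positivity),
        ← ENNReal.ofReal_mul (by positivity)]
      refine ENNReal.ofReal_le_ofReal ?_
      have h3 : |w (x + h) - w x| ≤ |w (x + h) - w y| + |w x - w y| := by
        rw [abs_sub_comm (w x)]; exact abs_sub_le _ _ _
      calc _ ≤ (|w (x + h) - w y| + |w x - w y|) ^ Q :=
            Real.rpow_le_rpow (abs_nonneg _) h3 hQ.le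
        _ ≤ 2 ^ Q * (|w (x + h) - w y| ^ Q + |w x - w y| ^ Q) :=
            add_rpow_le hQ.le (abs_nonneg _) (abs_nonneg _)
        _ ≤ 2 ^ Q * (‖h‖ ^ ((N : ℝ) + σ) * (|w (x + h) - w y| ^ Q / ‖x + h - y‖ ^ ((N : ℝ) + σ)) +
            ‖h‖ ^ ((N : ℝ) + σ) * (|w x - w y| ^ Q / ‖x - y‖ ^ ((N : ℝ) + σ))) := by
            have := near _ _ e1
            have := near _ _ e2
            gcongr
        _ = _ := by ring
    calc ENNReal.ofReal (|w (x + h) - w x| ^ Q)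
        = ENNReal.ofReal (1 / v) * (ENNReal.ofReal (|w (x + h) - w x| ^ Q) * ENNReal.ofReal v) := by
          rw [mul_comm (ENNReal.ofReal (|w (x + h) - w x| ^ Q)), ← mul_assoc,
            ← ENNReal.ofReal_mul (by positivity), one_div_mul_cancel hv0.ne']
          simp
      _ ≤ _ := by rw [mul_assoc]; gcongr
  have hprod : AEMeasurable (fun x => ∫⁻ y in B, f x y)
      (volume.restrict (Metric.ball (0 : Euc N) r)) := by
    have := aemeasurable_gagliardo hw Q ((N : ℝ) + σ) (s := Metric.ball (0 : Euc N) r) (t := B)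
    exact this.lintegral_prod_right'
  have hctop : ENNReal.ofReal (1 / v) * c ≠ ⊤ :=
    ENNReal.mul_ne_top ENNReal.ofReal_ne_top ENNReal.ofReal_ne_top
  have e2 : ∀ t : ℝ, 0 ≤ t → ENNReal.ofReal t * 2 = ENNReal.ofReal (t * 2) := fun t ht => by
    rw [ENNReal.ofReal_mul ht, ENNReal.ofReal_ofNat]
  calc ∫⁻ x in Metric.ball 0 r, ENNReal.ofReal (|w (x + h) - w x| ^ Q)
      ≤ ∫⁻ x in Metric.ball 0 r, ENNReal.ofReal (1 / v) * c *
          ((∫⁻ y in B, f (x + h) y) + ∫⁻ y in B, f x y) := setLIntegral_mono' hrm hpt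
    _ = ENNReal.ofReal (1 / v) * c * ((∫⁻ x in Metric.ball 0 r, ∫⁻ y in B, f (x + h) y) +
          ∫⁻ x in Metric.ball 0 r, ∫⁻ y in B, f x y) := by
        rw [lintegral_const_mul' _ _ hctop, lintegral_add_right' _ hprod]
    _ ≤ ENNReal.ofReal (1 / v) * c * ((∫⁻ x in B, ∫⁻ y in B, f x y) +
          ∫⁻ x in B, ∫⁻ y in B, f x y) := by
        refine mul_le_mul_right (add_le_add ?_ ?_) _
        · refine setLIntegral_comp_add_right_le hrm hBm h (fun x hx => ?_)
            (fun x => ∫⁻ y in B, f x y)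
          rw [hB, mem_ball_zero_iff]
          have : ‖x‖ < r := by simpa using hx
          linarith [norm_add_le x h]
        · exact lintegral_mono_set (Metric.ball_subset_ball (by linarith))
    _ = _ := by
        rw [← two_mul, ← mul_assoc, hc, ← ENNReal.ofReal_mul (by positivity), e2 _ (by positivity)]
        congr 2
        rw [hv, Real.rpow_add hh0, Real.rpow_natCast, div_pow]
        field_simp

/-! ### First differences from second differences -/

/-- Passing from `h` to `2 h` halves the first difference up to a second difference. Iterated, this
loses `2 ^ α / 2 < 1` per doubling. -/
theorem diff_eq_half (h : Euc N) (u : Euc N → ℝ) :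
    diff h u = fun x => (1 / 2 : ℝ) • (diff (h + h) u x - diff2 h u x) := by
  funext x
  simp only [diff, diff2, smul_eq_mul, add_assoc]
  ring

/-- First differences are controlled by second differences below the exponent one. -/
theorem eLpNorm_diff_le_of_diff2 {u : Euc N → ℝ} (hu : AEStronglyMeasurable u) {s : Set (Euc N)}
    {q : ℝ≥0∞} (hq : 1 ≤ q) {α h₀ : ℝ} (hα1 : α < 1) (h0 : 0 < h₀) (h1 : h₀ ≤ 1)
    {S M : ℝ≥0∞}
    (hS : ∀ h : Euc N, 0 < ‖h‖ → ‖h‖ < h₀ →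
      eLpNorm (diff2 h u) q (volume.restrict s) ≤ ENNReal.ofReal (‖h‖ ^ α) * S)
    (hM : ∀ h : Euc N, ‖h‖ < h₀ → eLpNorm (diff h u) q (volume.restrict s) ≤ M)
    {h : Euc N} (hh : 0 < ‖h‖) (hh0 : ‖h‖ < h₀) :
    eLpNorm (diff h u) q (volume.restrict s) ≤
      ENNReal.ofReal (‖h‖ ^ α) * (ENNReal.ofReal (1 / (2 - 2 ^ α)) * S +
        ENNReal.ofReal (2 / h₀) * M) := by
  have h2α : (2 : ℝ) ^ α < 2 := by
    calc (2 : ℝ) ^ α < 2 ^ (1 : ℝ) := Real.rpow_lt_rpow_of_exponent_lt (by norm_num) hα1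
      _ = 2 := by norm_num
  have hκ : 0 < 2 - (2 : ℝ) ^ α := by linarith
  set κ := 1 / (2 - (2 : ℝ) ^ α) with hκd
  have hκ0 : 0 < κ := by positivity
  -- The value of `κ` is the fixed point of the recursion `κ ↦ (2 ^ α κ + 1) / 2`, so the constant
  -- does not grow with the number of doublings.
  have hκe : 2 ^ α * κ + 1 = 2 * κ := by
    rw [hκd]; field_simp; ring
  have hshift : ∀ k : Euc N, AEStronglyMeasurable (fun x => u (x + k)) :=
    fun k => hu.comp_quasiMeasurePreserving (measurePreserving_add_right volume k).quasiMeasurePreserving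
  have hd : ∀ k : Euc N, AEStronglyMeasurable (diff k u) := fun k => (hshift k).sub hu
  have hd2 : ∀ k : Euc N, AEStronglyMeasurable (diff2 k u) := fun k => by
    have : diff2 k u = fun x => (u (x + (k + k)) - u (x + k)) - diff k u x := by
      funext x; simp [diff2, diff, add_assoc]
    rw [this]
    exact ((hshift _).sub (hshift _)).sub (hd k)
  -- Once `‖h‖ ≥ h₀ / 2` no further doubling is possible, and the crude bound `M` is used at the
  -- price `2 / h₀`.
  have base : ∀ h : Euc N, ‖h‖ < h₀ → h₀ ≤ 2 * ‖h‖ →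
      eLpNorm (diff h u) q (volume.restrict s) ≤
      ENNReal.ofReal (‖h‖ ^ α) * (ENNReal.ofReal κ * S + ENNReal.ofReal (2 / h₀) * M) := by
    intro h hlt hge
    have hpos : 0 < ‖h‖ := by linarith
    calc _ ≤ ENNReal.ofReal 1 * M := by rw [ENNReal.ofReal_one, one_mul]; exact hM h hlt
      _ ≤ ENNReal.ofReal (‖h‖ ^ α * (2 / h₀)) * M := by
        gcongr
        have : ‖h‖ ≤ ‖h‖ ^ α := by
          calc ‖h‖ = ‖h‖ ^ (1 : ℝ) := by simp
            _ ≤ _ := Real.rpow_le_rpow_of_exponent_ge hpos (by linarith) hα1.le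
        rw [mul_div_assoc', le_div_iff₀ h0]; linarith
      _ = ENNReal.ofReal (‖h‖ ^ α) * (ENNReal.ofReal (2 / h₀) * M) := by
        rw [ENNReal.ofReal_mul (by positivity), mul_assoc]
      _ ≤ _ := by gcongr; exact le_add_self
  have main : ∀ n : ℕ, ∀ h : Euc N, 0 < ‖h‖ → ‖h‖ < h₀ → h₀ ≤ 2 ^ n * (2 * ‖h‖) →
      eLpNorm (diff h u) q (volume.restrict s) ≤
      ENNReal.ofReal (‖h‖ ^ α) * (ENNReal.ofReal κ * S + ENNReal.ofReal (2 / h₀) * M) := by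
    intro n
    induction n with
    | zero => intro h _ hlt hge; exact base h hlt (by simpa using hge)
    | succ n ih =>
      intro h hpos hlt hge
      rcases le_or_gt h₀ (2 * ‖h‖) with hc | hc
      · exact base h hlt hc
      have hn : ‖h + h‖ = 2 * ‖h‖ := by rw [← two_smul ℝ h, norm_smul]; norm_num
      have ih' := ih (h + h) (by rw [hn]; positivity) (by rw [hn]; exact hc)
        (by rw [hn]; rw [pow_succ] at hge; linarith)
      rw [hn, Real.mul_rpow (by norm_num) hpos.le] at ih'
      have hs' := hS h hpos hlt
      set X := ENNReal.ofReal (‖h‖ ^ α) with hX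
      rw [ENNReal.ofReal_mul (by positivity), ← hX] at ih'
      rw [diff_eq_half]
      have e1 : eLpNorm (fun x => (1 / 2 : ℝ) • (diff (h + h) u x - diff2 h u x)) q
          (volume.restrict s) ≤ ENNReal.ofReal (1 / 2) *
          (eLpNorm (diff (h + h) u) q (volume.restrict s) +
            eLpNorm (diff2 h u) q (volume.restrict s)) := by
        have := eLpNorm_const_smul (1 / 2 : ℝ) (diff (h + h) u - diff2 h u) q (volume.restrict s)
        have e2 : (fun x => (1 / 2 : ℝ) • (diff (h + h) u x - diff2 h u x)) =
          (1 / 2 : ℝ) • (diff (h + h) u - diff2 h u) := rfl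
        rw [e2, this, Real.enorm_of_nonneg (by norm_num)]
        gcongr
        exact eLpNorm_sub_le (hd _).restrict (hd2 _).restrict hq
      refine e1.trans ?_
      calc _ ≤ ENNReal.ofReal (1 / 2) * (ENNReal.ofReal (2 ^ α) * X *
            (ENNReal.ofReal κ * S + ENNReal.ofReal (2 / h₀) * M) + X * S) := by gcongr
        _ = X * ((ENNReal.ofReal (1 / 2) * (ENNReal.ofReal (2 ^ α) * ENNReal.ofReal κ + 1)) * S +
            ENNReal.ofReal (1 / 2) * ENNReal.ofReal (2 ^ α) * (ENNReal.ofReal (2 / h₀) * M)) := by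
            ring
        _ ≤ X * (ENNReal.ofReal κ * S + 1 * (ENNReal.ofReal (2 / h₀) * M)) := by
            gcongr
            · rw [← ENNReal.ofReal_mul (by positivity), ← ENNReal.ofReal_one,
                ← ENNReal.ofReal_add (by positivity) (by norm_num), hκe,
                ← ENNReal.ofReal_mul (by norm_num)]
              apply ENNReal.ofReal_le_ofReal; linarith
            · rw [← ENNReal.ofReal_mul (by norm_num), ← ENNReal.ofReal_one]
              apply ENNReal.ofReal_le_ofReal; linarith
        _ = _ := by rw [one_mul]
  obtain ⟨n, hn⟩ := pow_unbounded_of_one_lt (h₀ / (2 * ‖h‖)) (one_lt_two (α := ℝ))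
  rw [div_lt_iff₀ (by positivity)] at hn
  exact main n h hh hh0 hn.le

/-! ### Cutoff, test function and its admissibility -/

/-- The radial cutoff equal to `1` on `B_{a-d}` and to `0` outside `B_a`. -/
noncomputable def cutoff (a d : ℝ) (x : Euc N) : ℝ := max 0 (min 1 ((a - ‖x‖) / d))

theorem cutoff_nonneg (a d : ℝ) (x : Euc N) : 0 ≤ cutoff a d x := le_max_left _ _

theorem cutoff_le_one (a d : ℝ) (x : Euc N) : cutoff a d x ≤ 1 :=
  max_le zero_le_one (min_le_left _ _)

theorem cutoff_eq_zero {a d : ℝ} (hd : 0 < d) {x : Euc N} (hx : a ≤ ‖x‖) : cutoff a d x = 0 := by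
  refine max_eq_left ((min_le_right _ _).trans ?_)
  exact div_nonpos_of_nonpos_of_nonneg (by linarith) hd.le

theorem cutoff_eq_one {a d : ℝ} (hd : 0 < d) {x : Euc N} (hx : ‖x‖ ≤ a - d) :
    cutoff a d x = 1 := by
  have : 1 ≤ (a - ‖x‖) / d := by rw [le_div_iff₀ hd]; linarith
  rw [cutoff, min_eq_left this, max_eq_right zero_le_one]

theorem abs_cutoff_sub_le {a d : ℝ} (hd : 0 < d) (x y : Euc N) :
    |cutoff a d x - cutoff a d y| ≤ ‖x - y‖ / d := by
  have h1 := abs_max_sub_max_le_max (0 : ℝ) (min 1 ((a - ‖x‖) / d)) 0 (min 1 ((a - ‖y‖) / d))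
  have h2 := abs_min_sub_min_le_max (1 : ℝ) ((a - ‖x‖) / d) 1 ((a - ‖y‖) / d)
  have h3 : ∀ t : ℝ, max 0 |t| = |t| := fun t => max_eq_right (abs_nonneg t)
  simp only [sub_self, abs_zero, h3] at h1 h2
  refine h1.trans (h2.trans ?_)
  rw [← sub_div, abs_div, abs_of_pos hd]
  gcongr
  rw [sub_sub_sub_cancel_left, ← norm_sub_rev y x]
  exact abs_norm_sub_norm_le y x

theorem measurable_cutoff (a d : ℝ) : Measurable (cutoff a d : Euc N → ℝ) := by
  unfold cutoff; fun_prop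

/-- The test function `J_{q+1}(w) η²`. -/
noncomputable def testFun (q a d : ℝ) (w : Euc N → ℝ) (x : Euc N) : ℝ :=
  J (q + 1) (w x) * cutoff a d x ^ 2

theorem testFun_eq_zero {q a d : ℝ} (hd : 0 < d) {w : Euc N → ℝ} {x : Euc N} (hx : a ≤ ‖x‖) :
    testFun q a d w x = 0 := by
  rw [testFun, cutoff_eq_zero hd hx]; simp

theorem abs_testFun_le {q a d : ℝ} (hq : 1 ≤ q) {w : Euc N → ℝ} {x : Euc N} :
    |testFun q a d w x| ≤ |w x| ^ q := by
  have h0 := cutoff_nonneg a d x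
  have h1 := cutoff_le_one a d x
  rw [testFun, abs_mul, abs_J (by linarith), add_sub_cancel_right,
    abs_of_nonneg (sq_nonneg (cutoff a d x))]
  exact mul_le_of_le_one_right (by positivity) (pow_le_one₀ h0 h1)

theorem aemeasurable_testFun {q a d : ℝ} {w : Euc N → ℝ} (hw : AEMeasurable w) :
    AEMeasurable (testFun q a d w) :=
  ((measurable_J _).comp_aemeasurable hw).mul ((measurable_cutoff a d).pow_const 2).aemeasurable

theorem abs_testFun_sub_le {q a d K : ℝ} (hq : 1 ≤ q) (hd : 0 < d) {w : Euc N → ℝ}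
    {x y : Euc N} (hx : |w x| ≤ K) (hy : |w y| ≤ K) :
    |testFun q a d w x - testFun q a d w y| ≤
      (q * K ^ (q - 1) + K ^ q * (2 / d)) * (|w x - w y| + ‖x - y‖) := by
  have hK : 0 ≤ K := (abs_nonneg _).trans hx
  have h1 := abs_J_add_one_sub_le hq hx hy
  have hGy : |J (q + 1) (w y)| ≤ K ^ q := by
    rw [abs_J (by linarith), add_sub_cancel_right]
    exact Real.rpow_le_rpow (abs_nonneg _) hy (by linarith)
  have e0 := cutoff_nonneg a d x
  have e1 := cutoff_le_one a d x
  have f0 := cutoff_nonneg a d y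
  have f1 := cutoff_le_one a d y
  have e2 : |cutoff a d x ^ 2 - cutoff a d y ^ 2| ≤ 2 / d * ‖x - y‖ := by
    have := abs_cutoff_sub_le (a := a) hd x y
    rw [sq_sub_sq, abs_mul, abs_of_nonneg (add_nonneg e0 f0)]
    calc _ ≤ 2 * (‖x - y‖ / d) := by gcongr; linarith
      _ = _ := by ring
  have e3 : cutoff a d x ^ 2 ≤ 1 := pow_le_one₀ e0 e1
  rw [testFun, testFun]
  have hs : J (q + 1) (w x) * cutoff a d x ^ 2 - J (q + 1) (w y) * cutoff a d y ^ 2 =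
    (J (q + 1) (w x) - J (q + 1) (w y)) * cutoff a d x ^ 2 +
      J (q + 1) (w y) * (cutoff a d x ^ 2 - cutoff a d y ^ 2) := by ring
  rw [hs]
  refine (abs_add_le _ _).trans ?_
  rw [abs_mul, abs_mul, abs_of_nonneg (sq_nonneg (cutoff a d x))]
  have g1 : 0 ≤ q * K ^ (q - 1) := by positivity
  have g2 : 0 ≤ K ^ q * (2 / d) := by positivity
  calc _ ≤ (q * K ^ (q - 1) * |w x - w y|) * 1 + K ^ q * (2 / d * ‖x - y‖) := by gcongr
    _ ≤ _ := by
      have := mul_nonneg g1 (norm_nonneg (x - y))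
      have := mul_nonneg g2 (abs_nonneg (w x - w y))
      nlinarith

theorem lintegral_ball_norm_sub_rpow_le {e T : ℝ} {x : Euc N} (hx : x ∈ Metric.ball 0 T) :
    ∫⁻ y in Metric.ball (0 : Euc N) T, ENNReal.ofReal (‖x - y‖ ^ (e - N)) ≤
      ∫⁻ z in Metric.ball (0 : Euc N) (2 * T), ENNReal.ofReal (‖z‖ ^ (e - N)) := by
  have h := setLIntegral_comp_add_right_le (s := Metric.ball (0 : Euc N) T)
    (t := Metric.ball (0 : Euc N) (2 * T)) Metric.isOpen_ball.measurableSet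
    Metric.isOpen_ball.measurableSet (-x) (fun y hy => by
      have h1 : ‖x‖ < T := by simpa using hx
      have h2 : ‖y‖ < T := by simpa using hy
      rw [mem_ball_zero_iff]
      have := norm_add_le y (-x)
      rw [norm_neg] at this
      linarith) (fun z => ENNReal.ofReal (‖z‖ ^ (e - N)))
  refine le_trans (le_of_eq ?_) h
  congr 1; funext y
  rw [← sub_eq_add_neg, norm_sub_rev]

/-- The Gagliardo energy `∬_{Ω × Ω} |ψ(x) - ψ(y)|^p / |x - y|^a`. -/
noncomputable def energy (p a : ℝ) (Ω : Set (Euc N)) (ψ : Euc N → ℝ) : ℝ≥0∞ :=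
  ∫⁻ x in Ω, ∫⁻ y in Ω, ENNReal.ofReal (|ψ x - ψ y| ^ p / ‖x - y‖ ^ a)

theorem energy_comp_add_right_le {p a : ℝ} {r ρ : ℝ} {h : Euc N} (hr : r + ‖h‖ ≤ ρ)
    (ψ : Euc N → ℝ) :
    energy p a (Metric.ball 0 r) (fun x => ψ (x + h)) ≤ energy p a (Metric.ball 0 ρ) ψ := by
  have hm : ∀ r, MeasurableSet (Metric.ball (0 : Euc N) r) :=
    fun r => Metric.isOpen_ball.measurableSet
  have hsub : ∀ x ∈ Metric.ball (0 : Euc N) r, x + h ∈ Metric.ball (0 : Euc N) ρ := by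
    intro x hx
    have h1 : ‖x‖ < r := by simpa using hx
    rw [mem_ball_zero_iff]
    linarith [norm_add_le x h]
  have key := setLIntegral_comp_add_right_le (hm r) (hm ρ) h hsub
    (fun x => ∫⁻ y in Metric.ball 0 ρ, ENNReal.ofReal (|ψ x - ψ y| ^ p / ‖x - y‖ ^ a))
  refine le_trans (lintegral_mono fun x => ?_) key
  refine le_trans (le_of_eq ?_) (setLIntegral_comp_add_right_le (hm r) (hm ρ) h hsub
    (fun y => ENNReal.ofReal (|ψ (x + h) - ψ y| ^ p / ‖x + h - y‖ ^ a)))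
  simp only [add_sub_add_right_eq_sub]

theorem energy_diff_lt_top {u : Euc N → ℝ} (hu : AEMeasurable u) {p a : ℝ} (hp : 0 < p)
    {r ρ : ℝ} {h : Euc N} (hr : r + ‖h‖ ≤ ρ) (hE : energy p a (Metric.ball 0 ρ) u < ⊤) :
    energy p a (Metric.ball 0 r) (diff h u) < ⊤ := by
  have h1 : energy p a (Metric.ball 0 r) u ≤ energy p a (Metric.ball 0 ρ) u := by
    have hs : Metric.ball (0 : Euc N) r ⊆ Metric.ball 0 ρ :=
      Metric.ball_subset_ball (by linarith [norm_nonneg h])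
    exact (lintegral_mono_set hs).trans (lintegral_mono fun x => lintegral_mono_set hs)
  have h2 := energy_comp_add_right_le (p := p) (a := a) hr u
  set B := Metric.ball (0 : Euc N) r with hB
  have hle : energy p a B (diff h u) ≤
      ENNReal.ofReal (2 ^ p) * (energy p a B (fun x => u (x + h)) + energy p a B u) := by
    have hmeas := aemeasurable_gagliardo hu p a (s := B) (t := B)
    simp only [energy]
    rw [← lintegral_add_right' _ hmeas.lintegral_prod_right',
      ← lintegral_const_mul' _ _ ENNReal.ofReal_ne_top]
    refine lintegral_mono fun x => ?_
    have hmx : AEMeasurable (fun y => ENNReal.ofReal (|u x - u y| ^ p / ‖x - y‖ ^ a))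
        (volume.restrict B) := by
      have := hu.restrict (s := B)
      fun_prop
    simp only
    rw [← lintegral_add_right' _ hmx, ← lintegral_const_mul' _ _ ENNReal.ofReal_ne_top]
    refine lintegral_mono fun y => ?_
    simp only
    rw [← ENNReal.ofReal_add (by positivity) (by positivity),
      ← ENNReal.ofReal_mul (by positivity), ← add_div, mul_div_assoc']
    refine ENNReal.ofReal_le_ofReal ?_
    gcongr
    refine le_trans ?_ (add_rpow_le hp.le (abs_nonneg _) (abs_nonneg _))
    refine Real.rpow_le_rpow (abs_nonneg _) ?_ hp.le
    rw [diff, diff, show u (x + h) - u x - (u (y + h) - u y) =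
      (u (x + h) - u (y + h)) - (u x - u y) by ring]
    exact abs_sub _ _
  refine hle.trans_lt (ENNReal.mul_lt_top ENNReal.ofReal_lt_top (ENNReal.add_lt_top.2 ?_))
  exact ⟨h2.trans_lt hE, h1.trans_lt hE⟩

/-- A bounded function supported well inside a ball, which is dominated there by a function of
finite energy, has finite energy on every ball. -/
theorem energy_lt_top_of_le (hN : 1 ≤ N) {p b : ℝ} (hp : 0 < p) (hb : 0 ≤ b) (hbp : b < N + p)
    {a d T K L : ℝ} (hd : 0 < d) {w ψ : Euc N → ℝ} (hK : 0 ≤ K) (hψ : ∀ x, |ψ x| ≤ K)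
    (hψ0 : ∀ x, a ≤ ‖x‖ → ψ x = 0) (hL : 0 ≤ L)
    (hψL : ∀ x ∈ Metric.ball (0 : Euc N) (a + 2 * d), ∀ y ∈ Metric.ball (0 : Euc N) (a + 2 * d),
      |ψ x - ψ y| ≤ L * (|w x - w y| + ‖x - y‖))
    (hE : energy p b (Metric.ball 0 (a + 2 * d)) w < ⊤) :
    energy p b (Metric.ball 0 T) ψ < ⊤ := by
  set B := Metric.ball (0 : Euc N) (a + 2 * d) with hB
  have hBm : MeasurableSet B := Metric.isOpen_ball.measurableSet
  have hTm : MeasurableSet (Metric.ball (0 : Euc N) T) := Metric.isOpen_ball.measurableSet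
  set f : Euc N → Euc N → ℝ≥0∞ := fun x y =>
    ENNReal.ofReal (|w x - w y| ^ p / ‖x - y‖ ^ b) with hf
  set c := ENNReal.ofReal (L ^ p * 2 ^ p) with hc
  set c' := ENNReal.ofReal ((2 * K) ^ p / (2 * d) ^ b) with hc'
  -- Pairs inside `B` inherit the energy of `w` plus an integrable power of the distance. For any
  -- other pair with a nonzero increment, one point lies in the support and the other outside `B`,
  -- so the distance is at least `2 d`.
  set A : Euc N → Euc N → ℝ≥0∞ := fun x y => B.indicator (fun x' => B.indicator (f x') y) x with hA
  set g : Euc N → Euc N → ℝ≥0∞ := fun x y =>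
    c * ENNReal.ofReal (‖x - y‖ ^ ((N + p - b) - N)) + c' with hg
  have hpt : ∀ x y, ENNReal.ofReal (|ψ x - ψ y| ^ p / ‖x - y‖ ^ b) ≤ c * A x y + g x y := by
    intro x y
    rcases eq_or_ne x y with rfl | hxy
    · simp [Real.zero_rpow hp.ne']
    have hn : 0 < ‖x - y‖ := norm_pos_iff.2 (sub_ne_zero.2 hxy)
    by_cases hin : x ∈ B ∧ y ∈ B
    · refine le_trans ?_ (add_le_add_right (le_self_add) _)
      rw [hA]
      simp only
      rw [Set.indicator_of_mem hin.1, Set.indicator_of_mem hin.2, hf, hc]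
      simp only
      rw [← ENNReal.ofReal_mul (by positivity), ← ENNReal.ofReal_mul (by positivity),
        ← ENNReal.ofReal_add (by positivity) (by positivity)]
      refine ENNReal.ofReal_le_ofReal ?_
      have h1 : |ψ x - ψ y| ^ p ≤ L ^ p * (2 ^ p * (|w x - w y| ^ p + ‖x - y‖ ^ p)) := by
        calc _ ≤ (L * (|w x - w y| + ‖x - y‖)) ^ p :=
              Real.rpow_le_rpow (abs_nonneg _) (hψL x hin.1 y hin.2) hp.le
          _ = L ^ p * (|w x - w y| + ‖x - y‖) ^ p := Real.mul_rpow hL (by positivity)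
          _ ≤ _ := by
            have := add_rpow_le hp.le (abs_nonneg (w x - w y)) (norm_nonneg (x - y))
            gcongr
      have h2 : ‖x - y‖ ^ ((N + p - b) - N) = ‖x - y‖ ^ p / ‖x - y‖ ^ b := by
        rw [← Real.rpow_sub hn]; congr 1; ring
      rw [h2]
      calc _ ≤ L ^ p * (2 ^ p * (|w x - w y| ^ p + ‖x - y‖ ^ p)) / ‖x - y‖ ^ b := by gcongr
        _ = _ := by ring
    · refine le_trans ?_ (le_add_left le_add_self)
      by_cases hz : ψ x = 0 ∧ ψ y = 0
      · simp [hz.1, hz.2, Real.zero_rpow hp.ne']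
      refine ENNReal.ofReal_le_ofReal ?_
      have hfar : 2 * d ≤ ‖x - y‖ := by
        have h1 := norm_sub_norm_le x y
        have h2 := norm_sub_norm_le y x
        rw [norm_sub_rev] at h2
        simp only [hB, mem_ball_zero_iff, not_and_or, not_lt] at hin
        rcases hin with h | h
        · have : ‖y‖ < a := by
            by_contra hy
            exact hz ⟨hψ0 x (by linarith), hψ0 y (by linarith)⟩
          linarith
        · have : ‖x‖ < a := by
            by_contra hy
            exact hz ⟨hψ0 x (by linarith), hψ0 y (by linarith)⟩
          linarith
      have h3 : |ψ x - ψ y| ≤ 2 * K := by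
        have := abs_sub (ψ x) (ψ y)
        linarith [hψ x, hψ y]
      gcongr
  set I := ∫⁻ z in Metric.ball (0 : Euc N) (2 * T), ENNReal.ofReal (‖z‖ ^ ((N + p - b) - N)) with hI
  have hItop : I < ⊤ := lintegral_ball_norm_rpow_lt_top hN (by linarith) _
  have hgx : ∀ x ∈ Metric.ball (0 : Euc N) T, ∫⁻ y in Metric.ball 0 T, g x y ≤
      c * I + c' * volume (Metric.ball (0 : Euc N) T) := by
    intro x hx
    rw [hg]
    simp only
    rw [lintegral_add_right _ measurable_const, lintegral_const_mul' _ _ ENNReal.ofReal_ne_top,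
      setLIntegral_const]
    gcongr
    exact lintegral_ball_norm_sub_rpow_le hx
  have hAx : ∀ x, ∫⁻ y in Metric.ball 0 T, A x y ≤ B.indicator (fun x => ∫⁻ y in B, f x y) x := by
    intro x
    by_cases hx : x ∈ B
    · simp only [hA, Set.indicator_of_mem hx]
      rw [← lintegral_indicator hBm]
      exact setLIntegral_le_lintegral _ _
    · simp [hA, Set.indicator_of_notMem hx]
  have hgm : ∀ x, Measurable (g x) := fun x => by
    rw [hg]
    exact (((measurable_norm.comp (measurable_const.sub measurable_id)).pow_const
      _).ennreal_ofReal.const_mul _).add_const _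
  calc energy p b (Metric.ball 0 T) ψ
      ≤ ∫⁻ x in Metric.ball 0 T, ∫⁻ y in Metric.ball 0 T, (c * A x y + g x y) :=
        lintegral_mono fun x => lintegral_mono fun y => hpt x y
    _ ≤ ∫⁻ x in Metric.ball 0 T, (c * B.indicator (fun x => ∫⁻ y in B, f x y) x +
          (c * I + c' * volume (Metric.ball (0 : Euc N) T))) := by
        refine setLIntegral_mono' hTm fun x hx => ?_
        rw [lintegral_add_right _ (hgm x), lintegral_const_mul' _ _ ENNReal.ofReal_ne_top]
        exact add_le_add (mul_le_mul_right (hAx x) _) (hgx x hx)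
    _ ≤ c * energy p b B w +
          (c * I + c' * volume (Metric.ball (0 : Euc N) T)) * volume (Metric.ball (0 : Euc N) T) := by
        rw [lintegral_add_right _ measurable_const, lintegral_const_mul' _ _ ENNReal.ofReal_ne_top,
          setLIntegral_const]
        refine add_le_add (mul_le_mul_right ?_ _) le_rfl
        refine (setLIntegral_le_lintegral _ _).trans ?_
        rw [lintegral_indicator hBm]
        exact le_rfl
    _ < ⊤ := by
        have hv : volume (Metric.ball (0 : Euc N) T) < ⊤ := measure_ball_lt_top
        exact ENNReal.add_lt_top.2 ⟨ENNReal.mul_lt_top ENNReal.ofReal_lt_top hE,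
          ENNReal.mul_lt_top (ENNReal.add_lt_top.2 ⟨ENNReal.mul_lt_top ENNReal.ofReal_lt_top hItop,
            ENNReal.mul_lt_top ENNReal.ofReal_lt_top hv⟩) hv⟩

/-- Translates of the test function are admissible in the weak formulation on `B_2`. -/
theorem memW_testFun (hN : 1 ≤ N) {s p q : ℝ} (hp : 1 < p) (hs : 0 < s) (hs1 : s < 1) (hq : 1 ≤ q)
    {a d K : ℝ} (hd : 0 < d) {w : Euc N → ℝ} (hw : AEMeasurable w)
    (hwK : ∀ x ∈ Metric.ball (0 : Euc N) (a + 2 * d), |w x| ≤ K) (hK : 0 ≤ K)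
    (hE : energy p (N + s * p) (Metric.ball 0 (a + 2 * d)) w < ⊤) {k : Euc N} (hk : ‖k‖ ≤ 1) :
    MemW s p (Metric.ball 0 2) (fun x => testFun q a d w (x + k)) := by
  have hψ : ∀ x, |testFun q a d w x| ≤ K ^ q := by
    intro x
    by_cases hx : x ∈ Metric.ball (0 : Euc N) (a + 2 * d)
    · exact (abs_testFun_le hq).trans
        (Real.rpow_le_rpow (abs_nonneg _) (hwK x hx) (by linarith))
    · rw [mem_ball_zero_iff, not_lt] at hx
      rw [testFun_eq_zero hd (by linarith), abs_zero]
      positivity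
  -- Radius 3 suffices: a shift of length at most 1 sends `B_2` into `B_3`.
  have hfin := energy_lt_top_of_le hN (b := N + s * p) (by linarith : 0 < p) (by positivity)
    (by nlinarith) (T := 3) (K := K ^ q) (L := q * K ^ (q - 1) + K ^ q * (2 / d)) hd
    (by positivity) hψ (fun x hx => testFun_eq_zero hd hx) (by positivity)
    (fun x hx y hy => abs_testFun_sub_le hq hd (hwK x hx) (hwK y hy)) hE
  refine ⟨?_, ?_⟩
  · have hm : AEStronglyMeasurable (fun x => testFun q a d w (x + k)) volume :=
      (aemeasurable_testFun hw).aestronglyMeasurable.comp_quasiMeasurePreserving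
        (measurePreserving_add_right volume k).quasiMeasurePreserving
    have : IsFiniteMeasure (volume.restrict (Metric.ball (0 : Euc N) 2)) :=
      ⟨by rw [Measure.restrict_apply_univ]; exact measure_ball_lt_top⟩
    exact MemLp.of_bound hm.restrict (K ^ q) (Filter.Eventually.of_forall fun x => hψ _)
  · refine ENNReal.rpow_lt_top_of_nonneg (by positivity) (ne_of_lt ?_)
    exact (energy_comp_add_right_le (r := 2) (ρ := 3) (by linarith) (testFun q a d w)).trans_lt hfin

theorem support_testFun_comp_add_subset {q a d : ℝ} (hd : 0 < d) {w : Euc N → ℝ} (k : Euc N) :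
    Function.support (fun x => testFun q a d w (x + k)) ⊆ Metric.closedBall 0 (a + ‖k‖) := by
  intro x hx
  rw [mem_closedBall_zero_iff]
  by_contra h
  refine hx (testFun_eq_zero hd ?_)
  have := norm_sub_norm_le x (-k)
  rw [norm_neg, sub_neg_eq_add] at this
  linarith

/-! ### The differenced equation -/

/-- The positive and negative parts of `F` have equal finite integrals, which cancel. Stating the
pointwise bound with both parts avoids subtraction in `ℝ≥0∞` and any measurability of `P` or `Q`; in
particular the finiteness of the energy `P` is a conclusion. -/
theorem lintegral_le_of_integral_eq_zero {X : Type*} [MeasurableSpace X] {μ : Measure X}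
    {F : X → ℝ} (hF : Integrable F μ) (h0 : ∫ z, F z ∂μ = 0) {P Q : X → ℝ≥0∞}
    (h : ∀ z, P z + ENNReal.ofReal (-F z) ≤ ENNReal.ofReal (F z) + Q z) :
    ∫⁻ z, P z ∂μ ≤ ∫⁻ z, Q z ∂μ := by
  have h1 : ∫⁻ z, ENNReal.ofReal (F z) ∂μ < ⊤ := hF.lintegral_lt_top
  have h2 : ∫⁻ z, ENNReal.ofReal (-F z) ∂μ < ⊤ := hF.neg.lintegral_lt_top
  rw [integral_eq_lintegral_pos_part_sub_lintegral_neg_part hF, sub_eq_zero,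
    ENNReal.toReal_eq_toReal_iff' h1.ne h2.ne] at h0
  have h3 : ∫⁻ z, P z ∂μ + ∫⁻ z, ENNReal.ofReal (-F z) ∂μ ≤
      ∫⁻ z, ENNReal.ofReal (-F z) ∂μ + ∫⁻ z, Q z ∂μ := by
    rw [← h0, ← lintegral_add_left' hF.aemeasurable.ennreal_ofReal, h0]
    exact (le_lintegral_add _ _).trans (lintegral_mono h)
  rw [add_comm] at h3
  exact (ENNReal.add_le_add_iff_left h2.ne).1 h3

theorem ofReal_add_ofReal_neg_le {P F Q : ℝ} (hP : 0 ≤ P) (hQ : 0 ≤ Q) (h : P ≤ F + Q) :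
    ENNReal.ofReal P + ENNReal.ofReal (-F) ≤ ENNReal.ofReal F + ENNReal.ofReal Q := by
  rcases le_total 0 F with hF | hF
  · rw [ENNReal.ofReal_of_nonpos (neg_nonpos.2 hF), add_zero, ← ENNReal.ofReal_add hF hQ]
    exact ENNReal.ofReal_le_ofReal h
  · rw [ENNReal.ofReal_of_nonpos hF, zero_add, ← ENNReal.ofReal_add hP (by linarith)]
    exact ENNReal.ofReal_le_ofReal (by linarith)

/-- The integrand of the equation satisfied by the first difference of a solution. -/
noncomputable def diffIntegrand (s p : ℝ) (u : Euc N → ℝ) (h : Euc N) (φ : Euc N → ℝ)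
    (z : Euc N × Euc N) : ℝ :=
  weakIntegrand s p (fun x => u (x + h)) φ z - weakIntegrand s p u φ z

/-- Testing with `φ(· - h)` and translating both variables by `h` gives the equation for `u(· + h)`
tested with `φ`. Subtracting the equation for `u` leaves the differenced one. -/
theorem integral_diffIntegrand {s p : ℝ} {Ω : Set (Euc N)} {u φ : Euc N → ℝ} {h : Euc N}
    (hu : IsLocalWeakSolution s p Ω u) (hφ : MemW s p Ω φ) (hφc : HasCompactSupport φ)
    (hφΩ : tsupport φ ⊆ Ω) (hψ : MemW s p Ω fun x => φ (x + -h))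
    (hψc : HasCompactSupport fun x => φ (x + -h)) (hψΩ : tsupport (fun x => φ (x + -h)) ⊆ Ω) :
    Integrable (diffIntegrand s p u h φ) (volume.prod volume) ∧
      ∫ z, diffIntegrand s p u h φ z ∂(volume.prod volume) = 0 := by
  obtain ⟨i1, z1⟩ := hu.2.2 φ hφ hφc hφΩ
  obtain ⟨i2, z2⟩ := hu.2.2 _ hψ hψc hψΩ
  have e : (fun z => weakIntegrand s p u (fun x => φ (x + -h)) (z + (h, h))) =
      weakIntegrand s p (fun x => u (x + h)) φ := by
    funext z
    simp [weakIntegrand]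
  have i3 := i2.comp_add_right (h, h)
  have z3 := integral_add_right_eq_self (μ := (volume : Measure (Euc N)).prod volume)
    (weakIntegrand s p u (fun x => φ (x + -h))) (h, h)
  rw [e] at i3
  rw [z2, e] at z3
  refine ⟨i3.sub i1, ?_⟩
  have := integral_sub i3 i1
  rw [z1, z3, sub_zero] at this
  exact this

theorem diffIntegrand_swap (s p : ℝ) (u : Euc N → ℝ) (h : Euc N) (φ : Euc N → ℝ)
    (x y : Euc N) : diffIntegrand s p u h φ (x, y) = diffIntegrand s p u h φ (y, x) := by
  have e : ∀ v : Euc N → ℝ, weakIntegrand s p v φ (x, y) = weakIntegrand s p v φ (y, x) := by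
    intro v
    simp only [weakIntegrand]
    rw [← neg_sub (v y) (v x), J_neg, norm_sub_rev, ← neg_sub (φ y) (φ x), neg_mul_neg]
  rw [diffIntegrand, diffIntegrand, e, e]

theorem diffIntegrand_eq (s p : ℝ) (u : Euc N → ℝ) (h : Euc N) (φ : Euc N → ℝ) (x y : Euc N) :
    diffIntegrand s p u h φ (x, y) =
      (J p (u (x + h) - u (y + h)) - J p (u x - u y)) * (φ x - φ y) /
        ‖x - y‖ ^ ((N : ℝ) + s * p) := by
  simp only [diffIntegrand, weakIntegrand]
  ring

/-- Lower bound for the integrand near the support of the test function. -/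
theorem le_diffIntegrand_add {s p q γ d a : ℝ} (hp : 1 < p) (hp2 : p < 2) (hq : 1 ≤ q)
    (hd : 0 < d) {u : Euc N → ℝ} {h x y : Euc N}
    (hx : |diff h u x| ≤ 6) (hy : |diff h u y| ≤ 6)
    (h1 : |u (x + h) - u (y + h)| ≤ ‖x - y‖ ^ γ) (h2 : |u x - u y| ≤ ‖x - y‖ ^ γ) :
    (p - 1) * 2 ^ (-q) / 4 * (cutoff a d x ^ 2 + cutoff a d y ^ 2) *
        (|diff h u x - diff h u y| ^ (q + 1) / ‖x - y‖ ^ ((N : ℝ) + (s * p - γ * (p - 2)))) ≤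
      diffIntegrand s p u h (testFun q a d (diff h u)) (x, y) +
        48 * 2 ^ q * (2 ^ (-q) / 8) ^ (1 - p) * d ^ (-p) *
          (|diff h u x| ^ q + |diff h u y| ^ q) * ‖x - y‖ ^ ((p - s * p) - N) := by
  rcases eq_or_ne x y with rfl | hxy
  · have h3 : (0 : ℝ) ^ (q + 1) = 0 := Real.zero_rpow (by linarith)
    rw [diffIntegrand_eq]
    simp only [sub_self, abs_zero, h3, zero_div, mul_zero, zero_add]
    positivity
  have hn : 0 < ‖x - y‖ := norm_pos_iff.2 (sub_ne_zero.2 hxy)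
  set w := diff h u with hw
  set t := ‖x - y‖ with ht
  have key := le_J_sub_mul_cutoff hp hp2 hq (M := t ^ γ) (by positivity) h1 h2
    (w₁ := w x) (w₂ := w y) (by rw [hw]; simp only [diff]; ring)
    (cutoff_nonneg a d x) (cutoff_le_one a d x) (cutoff_nonneg a d y) (cutoff_le_one a d y)
  set m := |w x| + |w y| with hm
  have hm0 : 0 ≤ m := by positivity
  have hm12 : m ≤ 12 := by linarith
  -- The surplus power `m ^ (p - 1)` is bounded because `u` is, so exactly the power `q` of `w`
  -- remains.
  have hmq : m ^ (q + p - 1) ≤ 12 * (2 ^ q * (|w x| ^ q + |w y| ^ q)) := by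
    have e1 : m ^ (q + p - 1) = m ^ (p - 1) * m ^ q := by
      rw [← Real.rpow_add_of_nonneg hm0 (by linarith) (by linarith)]; congr 1; ring
    have e2 : m ^ (p - 1) ≤ 12 := by
      calc m ^ (p - 1) ≤ 12 ^ (p - 1) := Real.rpow_le_rpow hm0 hm12 (by linarith)
        _ ≤ 12 ^ (1 : ℝ) := Real.rpow_le_rpow_of_exponent_le (by norm_num) (by linarith)
        _ = 12 := by norm_num
    rw [e1]
    have := add_rpow_le (r := q) (by linarith) (abs_nonneg (w x)) (abs_nonneg (w y))
    gcongr
  have hη : |cutoff a d x - cutoff a d y| ^ p ≤ d ^ (-p) * t ^ p := by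
    calc _ ≤ (t / d) ^ p :=
          Real.rpow_le_rpow (abs_nonneg _) (abs_cutoff_sub_le hd x y) (by linarith)
      _ = _ := by rw [Real.div_rpow hn.le hd.le, Real.rpow_neg hd.le]; ring
  set κ : ℝ := (2 ^ (-q) / 8) ^ (1 - p) with hκ
  have hκ0 : 0 < κ := by positivity
  set E := cutoff a d x ^ 2 + cutoff a d y ^ 2 with hE
  set X := (J p (u (x + h) - u (y + h)) - J p (u x - u y)) *
    (J (q + 1) (w x) * cutoff a d x ^ 2 - J (q + 1) (w y) * cutoff a d y ^ 2) with hX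
  have hF : diffIntegrand s p u h (testFun q a d w) (x, y) = X / t ^ ((N : ℝ) + s * p) := by
    rw [diffIntegrand_eq]; rfl
  have hb : 0 < t ^ ((N : ℝ) + s * p) := by positivity
  -- The Hölder bound enters here: taking `M = t ^ γ` in the monotonicity estimate changes the
  -- kernel exponent from `s p` to `s p - γ (p - 2)`.
  have e3 : (t ^ γ) ^ (p - 2) = t ^ ((N : ℝ) + s * p) / t ^ ((N : ℝ) + (s * p - γ * (p - 2))) := by
    rw [← Real.rpow_mul hn.le, ← Real.rpow_sub hn]; congr 1; ring
  have e4 : t ^ p / t ^ ((N : ℝ) + s * p) = t ^ ((p - s * p) - N) := by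
    rw [← Real.rpow_sub hn]; congr 1; ring
  have key2 : (p - 1) * 2 ^ (-q) / 4 * ((t ^ γ) ^ (p - 2) * |w x - w y| ^ (q + 1) * E) ≤
      X + 4 * κ * (12 * (2 ^ q * (|w x| ^ q + |w y| ^ q)) * (d ^ (-p) * t ^ p)) := by
    refine key.trans ?_
    gcongr
  rw [e3] at key2
  rw [hF, ← e4]
  have key3 := div_le_div_of_nonneg_right key2 hb.le
  calc _ = (p - 1) * 2 ^ (-q) / 4 * (t ^ ((N : ℝ) + s * p) /
          t ^ ((N : ℝ) + (s * p - γ * (p - 2))) * |w x - w y| ^ (q + 1) * E) /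
          t ^ ((N : ℝ) + s * p) := by
        field_simp
    _ ≤ _ := key3
    _ = _ := by ring

/-- Bound for the integrand away from the support of the test function. -/
theorem neg_diffIntegrand_le {s p q d a : ℝ} (hp : 1 < p) (hp2 : p < 2) (hq : 1 ≤ q)
    {u : Euc N → ℝ} {h x y : Euc N} (hx : |u x| ≤ 3) (hxh : |u (x + h)| ≤ 3)
    (hy : testFun q a d (diff h u) y = 0) :
    -diffIntegrand s p u h (testFun q a d (diff h u)) (x, y) ≤
      |diff h u x| ^ q * (((3 + |u y| ^ (p - 1)) + (3 + |u (y + h)| ^ (p - 1))) *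
        (1 / ‖x - y‖ ^ ((N : ℝ) + s * p))) := by
  have hJ : ∀ v v' : ℝ, |v| ≤ 3 → |J p (v - v')| ≤ 3 + |v'| ^ (p - 1) := by
    intro v v' hv
    rw [abs_J hp]
    calc |v - v'| ^ (p - 1) ≤ (|v| + |v'|) ^ (p - 1) :=
          Real.rpow_le_rpow (abs_nonneg _) (abs_sub _ _) (by linarith)
      _ ≤ |v| ^ (p - 1) + |v'| ^ (p - 1) :=
          add_rpow_le_add (by linarith) (by linarith) (abs_nonneg _) (abs_nonneg _)
      _ ≤ 3 + |v'| ^ (p - 1) := by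
          gcongr
          calc |v| ^ (p - 1) ≤ 3 ^ (p - 1) :=
                Real.rpow_le_rpow (abs_nonneg _) hv (by linarith)
            _ ≤ 3 ^ (1 : ℝ) := Real.rpow_le_rpow_of_exponent_le (by norm_num) (by linarith)
            _ = 3 := by norm_num
  rw [diffIntegrand_eq, hy, sub_zero]
  refine (neg_le_abs _).trans ?_
  rw [abs_div, abs_mul, abs_of_nonneg (by positivity : 0 ≤ ‖x - y‖ ^ ((N : ℝ) + s * p)),
    mul_one_div, ← mul_div_assoc, mul_comm |J p (u (x + h) - u (y + h)) - J p (u x - u y)|]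
  have h1 := hJ _ (u y) hx
  have h2 := hJ _ (u (y + h)) hxh
  have h3 := abs_sub (J p (u (x + h) - u (y + h))) (J p (u x - u y))
  have h4 : |testFun q a d (diff h u) x| ≤ |diff h u x| ^ q := abs_testFun_le hq
  gcongr
  linarith

/-! ### Error terms and the energy estimate -/

/-- The kernel of the error terms: a weakly singular part near the diagonal, and a tail part. -/
noncomputable def errorKernel (c e b d R : ℝ) (g : Euc N → ℝ≥0∞) (z : Euc N × Euc N) : ℝ≥0∞ :=
  {z : Euc N × Euc N | z.2 ∈ Metric.ball 0 R}.indicator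
      (fun z => ENNReal.ofReal c * ENNReal.ofReal (‖z.1 - z.2‖ ^ (e - N))) z +
    {z : Euc N × Euc N | 2 * d ≤ ‖z.1 - z.2‖}.indicator
      (fun z => g z.2 * ENNReal.ofReal (1 / ‖z.1 - z.2‖ ^ b)) z

theorem measurable_norm_sub_rpow (b : ℝ) :
    Measurable fun z : Euc N × Euc N => ‖z.1 - z.2‖ ^ b :=
  (by fun_prop : Measurable fun z : Euc N × Euc N => ‖z.1 - z.2‖).pow_const b

theorem aemeasurable_errorKernel {c e b d R : ℝ} {g : Euc N → ℝ≥0∞} (hg : AEMeasurable g) :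
    AEMeasurable (errorKernel c e b d R g) ((volume : Measure (Euc N)).prod volume) := by
  have h1 : MeasurableSet {z : Euc N × Euc N | z.2 ∈ Metric.ball 0 R} :=
    measurable_snd Metric.isOpen_ball.measurableSet
  have h2 : MeasurableSet {z : Euc N × Euc N | 2 * d ≤ ‖z.1 - z.2‖} :=
    measurableSet_le measurable_const (by fun_prop)
  have h3 : AEMeasurable (fun z : Euc N × Euc N => g z.2) ((volume : Measure (Euc N)).prod volume) :=
    hg.comp_quasiMeasurePreserving Measure.quasiMeasurePreserving_snd
  exact (((measurable_norm_sub_rpow (e - N)).ennreal_ofReal.const_mul _).aemeasurable.indicator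
    h1).add ((h3.mul ((measurable_norm_sub_rpow b).const_div 1).ennreal_ofReal.aemeasurable).indicator
      h2)

/-- The bound is uniform in `x`, so integrating against `|w| ^ q` leaves just the `L^q` mass of `w`.
The factor 2 on the tail counts the weights at `y` and `y + h`; the latter is reduced to the former
by moving the centre to `x + h`. -/
theorem lintegral_errorKernel_le {c e b d R : ℝ} (hb : 0 ≤ b) (hd : 0 < d) (hd1 : d ≤ 1 / 2)
    {h : Euc N} (hR : R + ‖h‖ ≤ 1) {g : Euc N → ℝ≥0∞} (hg : AEMeasurable g) {x : Euc N}
    (hx : x ∈ Metric.ball 0 R) :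
    ∫⁻ y, errorKernel c e b d R (fun y => g y + g (y + h)) (x, y) ≤
      ENNReal.ofReal c * (∫⁻ z in Metric.ball (0 : Euc N) 2, ENNReal.ofReal (‖z‖ ^ (e - N))) +
      ENNReal.ofReal (d ^ (-b)) * (2 * ((∫⁻ z in Metric.ball 0 1, g z) +
        ∫⁻ z in (Metric.ball 0 1)ᶜ, g z * ENNReal.ofReal (1 / ‖z‖ ^ b))) := by
  have hxR : ‖x‖ < R := by simpa using hx
  have hh := norm_nonneg h
  have hB : MeasurableSet (Metric.ball (0 : Euc N) R) := Metric.isOpen_ball.measurableSet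
  have hfar : ∀ x : Euc N, MeasurableSet {y : Euc N | 2 * d ≤ ‖x - y‖} :=
    fun x => measurableSet_le measurable_const (by fun_prop)
  have hm : ∀ (x : Euc N) (b : ℝ), Measurable fun y : Euc N => ‖x - y‖ ^ b := fun x b =>
    (by fun_prop : Measurable fun y : Euc N => ‖x - y‖).pow_const b
  have e1 : ∀ y, errorKernel c e b d R (fun y => g y + g (y + h)) (x, y) =
      (Metric.ball (0 : Euc N) R).indicator
        (fun y => ENNReal.ofReal c * ENNReal.ofReal (‖x - y‖ ^ (e - N))) y +
      {y : Euc N | 2 * d ≤ ‖x - y‖}.indicator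
        (fun y => g y * ENNReal.ofReal (1 / ‖x - y‖ ^ b) +
          g (y + h) * ENNReal.ofReal (1 / ‖x - y‖ ^ b)) y := by
    intro y
    simp only [errorKernel, ← add_mul]
    rfl
  simp_rw [e1]
  have hm1 : Measurable ((Metric.ball (0 : Euc N) R).indicator
      (fun y => ENNReal.ofReal c * ENNReal.ofReal (‖x - y‖ ^ (e - N)))) :=
    ((hm x _).ennreal_ofReal.const_mul _).indicator hB
  rw [lintegral_add_left hm1, lintegral_indicator hB, lintegral_indicator (hfar x),
    lintegral_const_mul' _ _ ENNReal.ofReal_ne_top]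
  have hm2 : AEMeasurable (fun y => g y * ENNReal.ofReal (1 / ‖x - y‖ ^ b))
      (volume.restrict {y : Euc N | 2 * d ≤ ‖x - y‖}) :=
    hg.restrict.mul ((hm x b).const_div 1).ennreal_ofReal.aemeasurable
  rw [lintegral_add_left' hm2]
  refine add_le_add (mul_le_mul' le_rfl ?_) ?_
  · exact (lintegral_ball_norm_sub_rpow_le hx).trans
      (lintegral_mono_set (Metric.ball_subset_ball (by linarith)))
  · rw [two_mul (_ + _), mul_add]
    refine add_le_add (lintegral_far_le hb hd hd1 (by linarith) g) ?_
    refine le_trans ?_ (lintegral_far_le hb hd hd1 (x₀ := x + h)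
      (by linarith [norm_add_le x h]) g)
    refine le_trans (le_of_eq ?_) (setLIntegral_comp_add_right_le (hfar x) (hfar (x + h)) h ?_
      (fun z => g z * ENNReal.ofReal (1 / ‖x + h - z‖ ^ b)))
    · simp only [add_sub_add_right_eq_sub]
    · intro y hy
      have hy : 2 * d ≤ ‖x - y‖ := hy
      simpa using hy

theorem lintegral_tailWeight_le {p b : ℝ} (hp : 1 < p) (hp2 : p < 2) {u : Euc N → ℝ}
    (hu3 : ∀ x ∈ Metric.ball (0 : Euc N) 1, |u x| ≤ 3)
    (htail : ∫⁻ x in (Metric.ball (0 : Euc N) 1)ᶜ, ENNReal.ofReal (|u x| ^ (p - 1) / ‖x‖ ^ b) ≤ 1) :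
    (∫⁻ z in Metric.ball (0 : Euc N) 1, ENNReal.ofReal (3 + |u z| ^ (p - 1))) +
        ∫⁻ z in (Metric.ball (0 : Euc N) 1)ᶜ,
          ENNReal.ofReal (3 + |u z| ^ (p - 1)) * ENNReal.ofReal (1 / ‖z‖ ^ b) ≤
      6 * volume (Metric.ball (0 : Euc N) 1) +
        (3 * (∫⁻ z in (Metric.ball (0 : Euc N) 1)ᶜ, ENNReal.ofReal (1 / ‖z‖ ^ b)) + 1) := by
  have hB : MeasurableSet (Metric.ball (0 : Euc N) 1) := Metric.isOpen_ball.measurableSet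
  refine add_le_add ?_ ?_
  · rw [← setLIntegral_const]
    refine setLIntegral_mono' hB fun z hz => ?_
    rw [← ENNReal.ofReal_ofNat 6]
    refine ENNReal.ofReal_le_ofReal ?_
    have : |u z| ^ (p - 1) ≤ 3 := by
      calc |u z| ^ (p - 1) ≤ 3 ^ (p - 1) :=
            Real.rpow_le_rpow (abs_nonneg _) (hu3 z hz) (by linarith)
        _ ≤ 3 ^ (1 : ℝ) := Real.rpow_le_rpow_of_exponent_le (by norm_num) (by linarith)
        _ = 3 := by norm_num
    linarith
  · refine le_trans ?_ (add_le_add_right htail _)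
    have hm : Measurable fun z : Euc N => ENNReal.ofReal (1 / ‖z‖ ^ b) :=
      ((measurable_norm.pow_const b).const_div 1).ennreal_ofReal
    rw [← lintegral_const_mul _ hm, ← lintegral_add_left (hm.const_mul _)]
    refine lintegral_mono fun z => ?_
    rw [ENNReal.ofReal_add (by norm_num) (by positivity), add_mul, ENNReal.ofReal_ofNat,
      ← ENNReal.ofReal_mul (by positivity), mul_one_div]

/-- Energy estimate for the first difference of a solution. -/
theorem energy_diff_le (hN : 1 ≤ N) {s p q : ℝ} (hp : 1 < p) (hp2 : p < 2) (hs : 0 < s)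
    (hs1 : s < 1) (hq : 1 ≤ q) (γ : ℝ) :
    ∃ K : ℝ, 0 < K ∧ ∀ (d R : ℝ) (u : Euc N → ℝ) (h : Euc N), 0 < d → d ≤ 1 / 2 → R + ‖h‖ ≤ 1 →
      AEMeasurable u → IsLocalWeakSolution s p (Metric.ball 0 2) u →
      (∀ x ∈ Metric.ball (0 : Euc N) 1, |u x| ≤ 3) →
      (∀ x ∈ Metric.ball (0 : Euc N) 1, ∀ y ∈ Metric.ball (0 : Euc N) 1,
        |u x - u y| ≤ ‖x - y‖ ^ γ) →
      ∫⁻ x in (Metric.ball (0 : Euc N) 1)ᶜ,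
        ENNReal.ofReal (|u x| ^ (p - 1) / ‖x‖ ^ ((N : ℝ) + s * p)) ≤ 1 →
      energy p (N + s * p) (Metric.ball 0 1) u < ⊤ →
      energy (q + 1) (N + (s * p - γ * (p - 2))) (Metric.ball 0 (R - 3 * d)) (diff h u) ≤
        ENNReal.ofReal (K * d ^ (-((N : ℝ) + s * p + p))) *
          ∫⁻ x in Metric.ball 0 R, ENNReal.ofReal (|diff h u x| ^ q) := by
  set b : ℝ := (N : ℝ) + s * p with hb
  have hsp : 0 < s * p := by positivity
  have hb0 : 0 ≤ b := by positivity
  have he : 0 < p - s * p := by nlinarith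
  set I := ∫⁻ z in Metric.ball (0 : Euc N) 2, ENNReal.ofReal (‖z‖ ^ ((p - s * p) - N)) with hI
  have hItop : I ≠ ⊤ := (lintegral_ball_norm_rpow_lt_top hN he 2).ne
  set T := 6 * volume (Metric.ball (0 : Euc N) 1) +
        (3 * (∫⁻ z in (Metric.ball (0 : Euc N) 1)ᶜ, ENNReal.ofReal (1 / ‖z‖ ^ b)) + 1) with hT
  have hTtop : T ≠ ⊤ := by
    have h1 : volume (Metric.ball (0 : Euc N) 1) < ⊤ := measure_ball_lt_top
    have h2 := lintegral_compl_ball_norm_rpow_lt_top (N := N) hsp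
    exact (ENNReal.add_lt_top.2 ⟨ENNReal.mul_lt_top (by simp) h1,
      ENNReal.add_lt_top.2 ⟨ENNReal.mul_lt_top (by simp) h2, by simp⟩⟩).ne
  set c₁ : ℝ := (p - 1) * 2 ^ (-q) / 4 with hc₁
  have hc₁0 : 0 < c₁ := by have := sub_pos.2 hp; positivity
  set C₁ : ℝ := 48 * 2 ^ q * (2 ^ (-q) / 8) ^ (1 - p) with hC₁
  have hC₁0 : 0 < C₁ := by positivity
  -- The outer 2 counts the error with the roles of `x` and `y` exchanged, the inner 2 the two tail
  -- weights; the `+ 1` gives positivity.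
  refine ⟨c₁⁻¹ * 2 * (C₁ * I.toReal + 2 * T.toReal + 1), by positivity, ?_⟩
  intro d R u h hd hd1 hR hu hsol hu3 hγ htail hE
  have hh := norm_nonneg h
  set w := diff h u with hw
  set B := Metric.ball (0 : Euc N) R with hB
  have hBm : MeasurableSet B := Metric.isOpen_ball.measurableSet
  have hin : ∀ x ∈ B, x ∈ Metric.ball (0 : Euc N) 1 := fun x hx =>
    Metric.ball_subset_ball (by linarith) hx
  have hinh : ∀ x ∈ B, x + h ∈ Metric.ball (0 : Euc N) 1 := fun x hx => by
    have : ‖x‖ < R := by simpa [hB] using hx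
    rw [mem_ball_zero_iff]
    linarith [norm_add_le x h]
  have hw6 : ∀ x ∈ B, |w x| ≤ 6 := fun x hx => by
    have h1 := hu3 _ (hin x hx)
    have h2 := hu3 _ (hinh x hx)
    exact (abs_sub _ _).trans (by linarith)
  have hum : ∀ k : Euc N, AEMeasurable fun x => u (x + k) := fun k =>
    hu.comp_quasiMeasurePreserving (measurePreserving_add_right volume k).quasiMeasurePreserving
  have hwm : AEMeasurable w := (hum h).sub hu
  -- The cutoff falls from 1 to 0 between `B_{R-3d}` and `B_{R-2d}`. The remaining gap `2 d` keeps
  -- its support away from the complement of `B_R`, where only the tail of `u` is controlled.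
  set a := R - 2 * d with ha
  have had : a + 2 * d = R := by rw [ha]; ring
  have hEw : energy p b (Metric.ball 0 (a + 2 * d)) w < ⊤ := by
    rw [had]; exact energy_diff_lt_top hu (by linarith) hR hE
  have hw6' : ∀ x ∈ Metric.ball (0 : Euc N) (a + 2 * d), |w x| ≤ 6 := by rw [had]; exact hw6
  set φ := testFun q a d w with hφ
  have hadm : ∀ k : Euc N, ‖k‖ ≤ ‖h‖ → MemW s p (Metric.ball 0 2) (fun x => φ (x + k)) ∧
      HasCompactSupport (fun x => φ (x + k)) ∧
      tsupport (fun x => φ (x + k)) ⊆ Metric.ball 0 2 := by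
    intro k hk
    have hsub := support_testFun_comp_add_subset (q := q) (a := a) hd (w := w) k
    -- For negative `R` the test function vanishes; for `R ≥ 0` the condition `R + ‖h‖ ≤ 1` gives
    -- shifts of length at most 1.
    rcases lt_or_ge R 0 with hR0 | hR0
    · have hz : (fun x => φ (x + k)) = fun _ => 0 := by
        funext x
        exact testFun_eq_zero hd (by linarith [norm_nonneg (x + k)])
      rw [hz]
      refine ⟨⟨MemLp.zero, ?_⟩, HasCompactSupport.zero, by simp [tsupport]⟩
      have hp0 : (0 : ℝ) ^ p = 0 := Real.zero_rpow (by linarith)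
      simp [gagliardoSeminorm, hp0, show 0 < p by linarith]
    refine ⟨memW_testFun hN hp hs hs1 hq hd hwm hw6' (by norm_num) hEw (by linarith),
      HasCompactSupport.of_support_subset_isCompact (isCompact_closedBall _ _) hsub, ?_⟩
    refine (closure_minimal hsub Metric.isClosed_closedBall).trans ?_
    exact Metric.closedBall_subset_ball (by linarith)
  obtain ⟨m0, m1, m2⟩ := hadm 0 (by simp)
  obtain ⟨m3, m4, m5⟩ := hadm (-h) (by simp)
  simp only [add_zero] at m0 m1 m2
  obtain ⟨hFi, hF0⟩ := integral_diffIntegrand hsol m0 m1 m2 m3 m4 m5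
  set F := diffIntegrand s p u h φ with hF
  set g : Euc N → ℝ≥0∞ := fun y => ENNReal.ofReal (3 + |u y| ^ (p - 1)) with hg
  have hgm : AEMeasurable g :=
    ((by fun_prop : Measurable fun t : ℝ => 3 + |t| ^ (p - 1)).comp_aemeasurable hu).ennreal_ofReal
  have hgm' : AEMeasurable fun y => g y + g (y + h) :=
    hgm.add (hgm.comp_quasiMeasurePreserving
      (measurePreserving_add_right volume h).quasiMeasurePreserving)
  set k := errorKernel (C₁ * d ^ (-p)) (p - s * p) b d R (fun y => g y + g (y + h)) with hk
  set W : Euc N → ℝ≥0∞ := B.indicator fun x => ENNReal.ofReal (|w x| ^ q) with hW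
  have hWm : AEMeasurable W :=
    ((by fun_prop : Measurable fun t : ℝ => |t| ^ q).comp_aemeasurable hwm).ennreal_ofReal.indicator
      hBm
  set Q : Euc N × Euc N → ℝ≥0∞ := fun z => W z.1 * k z with hQ
  have hQm : AEMeasurable Q ((volume : Measure (Euc N)).prod volume) :=
    (hWm.comp_quasiMeasurePreserving Measure.quasiMeasurePreserving_fst).mul
      (aemeasurable_errorKernel hgm')
  set B' := Metric.ball (0 : Euc N) (R - 3 * d) with hB'
  have hB'B : B' ⊆ B := Metric.ball_subset_ball (by linarith)
  have hB'm : MeasurableSet B' := Metric.isOpen_ball.measurableSet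
  set f : Euc N × Euc N → ℝ := fun z =>
    |w z.1 - w z.2| ^ (q + 1) / ‖z.1 - z.2‖ ^ ((N : ℝ) + (s * p - γ * (p - 2))) with hf
  have hfnn : ∀ z, 0 ≤ f z := fun z => by positivity
  set P : Euc N × Euc N → ℝ≥0∞ := (B' ×ˢ B').indicator fun z => ENNReal.ofReal (c₁ * f z) with hP
  have far : ∀ x y, y ∉ B → ENNReal.ofReal (-F (x, y)) ≤ Q (x, y) := by
    intro x y hy
    have hyR : R ≤ ‖y‖ := by simpa [hB] using hy
    have hy0 : φ y = 0 := testFun_eq_zero hd (by linarith)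
    by_cases hx0 : φ x = 0
    · rw [hF, diffIntegrand_eq, hx0, hy0]; simp
    have hxa : ‖x‖ < a := by
      by_contra hcon
      exact hx0 (testFun_eq_zero hd (by linarith))
    have hxB : x ∈ B := by rw [hB, mem_ball_zero_iff]; linarith
    have hxy : (x, y) ∈ {z : Euc N × Euc N | 2 * d ≤ ‖z.1 - z.2‖} := by
      have := norm_sub_norm_le y x
      rw [norm_sub_rev] at this
      show 2 * d ≤ ‖x - y‖
      linarith
    have h1 := neg_diffIntegrand_le (s := s) hp hp2 hq (hu3 _ (hin x hxB)) (hu3 _ (hinh x hxB)) hy0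
    refine (ENNReal.ofReal_le_ofReal h1).trans ?_
    rw [ENNReal.ofReal_mul (by positivity), ENNReal.ofReal_mul (by positivity),
      ENNReal.ofReal_add (by positivity) (by positivity)]
    simp only [hQ, hW, Set.indicator_of_mem hxB, hk, errorKernel]
    rw [Set.indicator_of_mem hxy]
    exact mul_le_mul_right le_add_self _
  -- If both points lie in `B`, coercivity applies with a weakly singular error. Otherwise `P`
  -- vanishes and the integrand is bounded by the tail kernel, using its symmetry when the outer
  -- point is `x`.
  have hpt : ∀ z, P z + ENNReal.ofReal (-F z) ≤ ENNReal.ofReal (F z) + (Q z + Q z.swap) := by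
    rintro ⟨x, y⟩
    by_cases hxy : x ∈ B ∧ y ∈ B
    · obtain ⟨hx, hy⟩ := hxy
      have key := le_diffIntegrand_add (s := s) (γ := γ) (a := a) hp hp2 hq hd (hw6 x hx)
        (hw6 y hy) (by simpa using hγ _ (hinh x hx) _ (hinh y hy)) (hγ _ (hin x hx) _ (hin y hy))
      have h1 : P (x, y) ≤ ENNReal.ofReal
          (c₁ * (cutoff a d x ^ 2 + cutoff a d y ^ 2) * f (x, y)) := by
        refine Set.indicator_apply_le' (fun hz => ENNReal.ofReal_le_ofReal ?_) (fun _ => zero_le)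
        have hz1 : ‖x‖ < R - 3 * d := by simpa [hB'] using hz.1
        have hz2 : ‖y‖ < R - 3 * d := by simpa [hB'] using hz.2
        rw [cutoff_eq_one hd (by linarith), cutoff_eq_one hd (by linarith)]
        have := mul_nonneg hc₁0.le (hfnn (x, y))
        linarith
      have h2 : ENNReal.ofReal (C₁ * d ^ (-p) * (|w x| ^ q + |w y| ^ q) *
          ‖x - y‖ ^ ((p - s * p) - N)) ≤ Q (x, y) + Q (x, y).swap := by
        have hQ1 : ∀ x ∈ B, ∀ y ∈ B, ENNReal.ofReal (|w x| ^ q) *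
            (ENNReal.ofReal (C₁ * d ^ (-p)) * ENNReal.ofReal (‖x - y‖ ^ ((p - s * p) - N))) ≤
            Q (x, y) := by
          intro x hx y hy
          have hy' : (x, y) ∈ {z : Euc N × Euc N | z.2 ∈ Metric.ball 0 R} := hy
          simp only [hQ, hW, Set.indicator_of_mem hx, hk, errorKernel]
          rw [Set.indicator_of_mem hy']
          exact mul_le_mul_right le_self_add _
        refine le_trans (le_of_eq ?_) (add_le_add (hQ1 x hx y hy) (hQ1 y hy x hx))
        rw [norm_sub_rev y x, ← add_mul, ← ENNReal.ofReal_add (by positivity) (by positivity),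
          ← ENNReal.ofReal_mul (by positivity), ← ENNReal.ofReal_mul (by positivity)]
        congr 1; ring
      refine (add_le_add_left h1 _).trans (le_trans ?_ (add_le_add_right h2 _))
      exact ofReal_add_ofReal_neg_le (by have := hfnn (x, y); positivity) (by positivity) key
    · have hP0 : P (x, y) = 0 := by
        refine Set.indicator_of_notMem (fun hz => hxy ⟨hB'B hz.1, hB'B hz.2⟩) _
      rw [hP0, zero_add]
      refine le_trans ?_ le_add_self
      rw [not_and_or] at hxy
      rcases hxy with h | h
      · have := far y x h
        rw [hF, diffIntegrand_swap, ← hF] at this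
        exact this.trans le_add_self
      · exact (far x y h).trans le_self_add
  have hmain := lintegral_le_of_integral_eq_zero hFi hF0 hpt
  have hPint : ∫⁻ z, P z ∂((volume : Measure (Euc N)).prod volume) =
      ENNReal.ofReal c₁ * energy (q + 1) (N + (s * p - γ * (p - 2))) B' w := by
    rw [hP, lintegral_indicator (hB'm.prod hB'm), ← Measure.prod_restrict]
    simp_rw [ENNReal.ofReal_mul hc₁0.le]
    rw [lintegral_const_mul' _ _ ENNReal.ofReal_ne_top,
      lintegral_prod _ (aemeasurable_gagliardo hwm _ _)]
    rfl
  set Λ := ENNReal.ofReal (C₁ * d ^ (-p)) * I + ENNReal.ofReal (d ^ (-b)) * (2 * T) with hΛ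
  have hQint : ∫⁻ z, (Q z + Q z.swap) ∂((volume : Measure (Euc N)).prod volume) ≤
      2 * (Λ * ∫⁻ x in B, ENNReal.ofReal (|w x| ^ q)) := by
    rw [lintegral_add_left' hQm, lintegral_prod_swap, ← two_mul]
    refine mul_le_mul_right ((lintegral_prod_le _).trans ?_) _
    have hΛtop : Λ ≠ ⊤ := ENNReal.add_ne_top.2 ⟨ENNReal.mul_ne_top ENNReal.ofReal_ne_top hItop,
      ENNReal.mul_ne_top ENNReal.ofReal_ne_top (ENNReal.mul_ne_top (by simp) hTtop)⟩
    rw [← lintegral_const_mul' _ _ hΛtop, ← lintegral_indicator hBm]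
    refine lintegral_mono fun x => ?_
    by_cases hx : x ∈ B
    · simp only [hQ, hW, Set.indicator_of_mem hx]
      rw [lintegral_const_mul' _ _ ENNReal.ofReal_ne_top, mul_comm]
      refine mul_le_mul_left ((lintegral_errorKernel_le hb0 hd hd1 hR hgm hx).trans ?_) _
      exact add_le_add le_rfl (mul_le_mul' le_rfl (mul_le_mul' le_rfl
        (lintegral_tailWeight_le hp hp2 hu3 htail)))
    · simp [hQ, hW, Set.indicator_of_notMem hx]
  rw [hPint] at hmain
  -- As `d ≤ 1`, the losses `d ^ (-p)` from the cutoff and `d ^ (-b)` from the tail both fit under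
  -- one power.
  have hd' : ∀ t : ℝ, 0 ≤ t → t ≤ b + p → d ^ (-t) ≤ d ^ (-(b + p)) := fun t _ ht =>
    Real.rpow_le_rpow_of_exponent_ge hd (by linarith) (by linarith)
  have hΛle : Λ ≤ ENNReal.ofReal ((C₁ * I.toReal + 2 * T.toReal + 1) * d ^ (-(b + p))) := by
    have hDp : 0 < d ^ (-(b + p)) := by positivity
    rw [hΛ, ← ENNReal.ofReal_toReal hItop, ← ENNReal.ofReal_toReal hTtop,
      ← ENNReal.ofReal_ofNat 2, ← ENNReal.ofReal_mul (by positivity),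
      ← ENNReal.ofReal_mul (by norm_num), ← ENNReal.ofReal_mul (by positivity),
      ← ENNReal.ofReal_add (by positivity) (by positivity)]
    refine ENNReal.ofReal_le_ofReal ?_
    rw [ENNReal.toReal_ofReal (by positivity), ENNReal.toReal_ofReal (by positivity)]
    calc C₁ * d ^ (-p) * I.toReal + d ^ (-b) * (2 * T.toReal)
        ≤ C₁ * d ^ (-(b + p)) * I.toReal + d ^ (-(b + p)) * (2 * T.toReal) := by
          have h1 := hd' p (by linarith) (by linarith)
          have h2 := hd' b hb0 (by linarith)
          gcongr
      _ ≤ _ := by nlinarith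
  calc energy (q + 1) (N + (s * p - γ * (p - 2))) B' w
      = ENNReal.ofReal c₁⁻¹ *
          (ENNReal.ofReal c₁ * energy (q + 1) (N + (s * p - γ * (p - 2))) B' w) := by
        rw [← mul_assoc, ← ENNReal.ofReal_mul (by positivity), inv_mul_cancel₀ hc₁0.ne']
        simp
    _ ≤ ENNReal.ofReal c₁⁻¹ * (2 * (ENNReal.ofReal ((C₁ * I.toReal + 2 * T.toReal + 1) *
          d ^ (-(b + p))) * ∫⁻ x in B, ENNReal.ofReal (|w x| ^ q))) := by
        exact mul_le_mul' le_rfl ((hmain.trans hQint).trans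
          (mul_le_mul' le_rfl (mul_le_mul' hΛle le_rfl)))
    _ = _ := by
        have e2 : ∀ t : ℝ, 0 ≤ t → ENNReal.ofReal t * 2 = ENNReal.ofReal (t * 2) := fun t ht => by
          rw [ENNReal.ofReal_mul ht, ENNReal.ofReal_ofNat]
        rw [← mul_assoc, ← mul_assoc, e2 _ (by positivity), ← ENNReal.ofReal_mul (by positivity),
          mul_assoc (c₁⁻¹ * 2)]

/-! ### Hypotheses in pointwise form and norm conversions -/

theorem MemTailSpace.aemeasurable {q a : ℝ} {u : Euc N → ℝ} (hu : MemTailSpace q a u) :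
    AEMeasurable u := by
  rw [← Measure.restrict_univ (μ := (volume : Measure (Euc N))),
    ← Metric.iUnion_closedBall_nat (0 : Euc N), aemeasurable_iUnion_iff]
  exact fun n => (hu.1 _ (isCompact_closedBall _ _)).1.aemeasurable

theorem abs_sub_le_of_holderSeminorm_le {γ : ℝ} {Ω : Set (Euc N)} {u : Euc N → ℝ}
    (hu : holderSeminorm γ Ω u ≤ 1) {x y : Euc N} (hx : x ∈ Ω) (hy : y ∈ Ω) :
    |u x - u y| ≤ ‖x - y‖ ^ γ := by
  rcases eq_or_ne x y with rfl | hxy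
  · simp only [sub_self, abs_zero]; positivity
  have hn : 0 < ‖x - y‖ := norm_pos_iff.2 (sub_ne_zero.2 hxy)
  have h1 : ENNReal.ofReal (|u x - u y| / ‖x - y‖ ^ γ) ≤ holderSeminorm γ Ω u :=
    le_iSup₂_of_le x hx (le_iSup₂_of_le y hy (le_iSup_of_le hxy le_rfl))
  have h2 := ENNReal.ofReal_le_one.1 (h1.trans hu)
  rwa [div_le_one (by positivity)] at h2

/-- The essential bound gives some point with `|u| ≤ 1`, and the Hölder bound limits the oscillation
to `2 ^ γ ≤ 2`. The result holds at every point, so it survives translation without exceptional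
sets. -/
theorem abs_le_three {γ : ℝ} (hγ : 0 ≤ γ) (hγ1 : γ ≤ 1) {u : Euc N → ℝ}
    (hu : eLpNorm u ⊤ (volume.restrict (Metric.ball (0 : Euc N) 1)) ≤ 1)
    (hH : holderSeminorm γ (Metric.ball (0 : Euc N) 1) u ≤ 1) {x : Euc N}
    (hx : x ∈ Metric.ball (0 : Euc N) 1) : |u x| ≤ 3 := by
  have hae : ∀ᵐ y ∂(volume.restrict (Metric.ball (0 : Euc N) 1)), |u y| ≤ 1 := by
    rw [eLpNorm_exponent_top] at hu
    filter_upwards [enorm_ae_le_eLpNormEssSup u (volume.restrict (Metric.ball (0 : Euc N) 1))]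
      with y hy
    have h1 := hy.trans hu
    rw [Real.enorm_eq_ofReal_abs] at h1
    exact ENNReal.ofReal_le_one.1 h1
  rw [ae_restrict_iff' Metric.isOpen_ball.measurableSet] at hae
  obtain ⟨y, hy, hy1⟩ : ∃ y ∈ Metric.ball (0 : Euc N) 1, |u y| ≤ 1 := by
    by_contra hcon
    push Not at hcon
    have hsub : Metric.ball (0 : Euc N) 1 ⊆ {y | ¬(y ∈ Metric.ball (0 : Euc N) 1 → |u y| ≤ 1)} :=
      fun y hy h => absurd (h hy) (not_le.2 (hcon y hy))
    have h0 : volume (Metric.ball (0 : Euc N) 1) = 0 := measure_mono_null hsub hae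
    exact (Metric.measure_ball_pos volume (0 : Euc N) one_pos).ne' h0
  have h1 := abs_sub_le_of_holderSeminorm_le hH hx hy
  have h2 : ‖x - y‖ ≤ 2 := by
    have h3 : ‖x‖ < 1 := by simpa using hx
    have h4 : ‖y‖ < 1 := by simpa using hy
    linarith [norm_sub_le x y]
  have h3 : ‖x - y‖ ^ γ ≤ 2 := by
    calc ‖x - y‖ ^ γ ≤ 2 ^ γ := Real.rpow_le_rpow (norm_nonneg _) h2 hγ
      _ ≤ 2 ^ (1 : ℝ) := Real.rpow_le_rpow_of_exponent_le (by norm_num) hγ1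
      _ = 2 := by norm_num
  have h4 := abs_sub_abs_le_abs_sub (u x) (u y)
  linarith

theorem lintegral_abs_rpow_eq {q : ℝ} (hq : 0 < q) (f : Euc N → ℝ) (μ : Measure (Euc N)) :
    ∫⁻ x, ENNReal.ofReal (|f x| ^ q) ∂μ = eLpNorm f (ENNReal.ofReal q) μ ^ q := by
  rw [eLpNorm_eq_lintegral_rpow_enorm_toReal (by simpa using hq) ENNReal.ofReal_ne_top,
    ENNReal.toReal_ofReal hq.le, ← ENNReal.rpow_mul, one_div_mul_cancel hq.ne', ENNReal.rpow_one]
  refine lintegral_congr fun x => ?_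
  rw [Real.enorm_eq_ofReal_abs, ENNReal.ofReal_rpow_of_nonneg (abs_nonneg _) hq.le]

theorem eLpNorm_diff2_le_secondDiffSup {α q h₀ r R : ℝ} {u : Euc N → ℝ} (hr : r ≤ R)
    {h : Euc N} (hh : 0 < ‖h‖) (hh0 : ‖h‖ < h₀) :
    eLpNorm (diff2 h u) (ENNReal.ofReal q) (volume.restrict (Metric.ball 0 r)) ≤
      ENNReal.ofReal (‖h‖ ^ α) * secondDiffSup α q h₀ R u := by
  have h1 : eLpNorm (fun x => diff2 h u x / ‖h‖ ^ α) (ENNReal.ofReal q)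
      (volume.restrict (Metric.ball 0 R)) ≤ secondDiffSup α q h₀ R u :=
    le_iSup₂_of_le h ⟨hh, hh0⟩ le_rfl
  have hpos : 0 < ‖h‖ ^ α := by positivity
  have h2 : diff2 h u = (‖h‖ ^ α) • fun x => diff2 h u x / ‖h‖ ^ α := by
    funext x
    rw [Pi.smul_apply, smul_eq_mul, mul_div_cancel₀ _ hpos.ne']
  rw [h2, eLpNorm_const_smul, Real.enorm_of_nonneg hpos.le]
  refine mul_le_mul' le_rfl (le_trans ?_ h1)
  exact eLpNorm_mono_measure _ (Measure.restrict_mono (Metric.ball_subset_ball hr) le_rfl)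

/-- The `L^q` norm of first differences in terms of the second differences. -/
theorem lintegral_diff_rpow_le {α q : ℝ} (hα1 : α < 1) (hq : 1 ≤ q) (N : ℕ) :
    ∃ K : ℝ, 0 < K ∧ ∀ (h₀ R : ℝ) (u : Euc N → ℝ) (h : Euc N), 0 < h₀ → h₀ ≤ 1 → R + h₀ ≤ 1 →
      AEMeasurable u → (∀ x ∈ Metric.ball (0 : Euc N) 1, |u x| ≤ 3) → 0 < ‖h‖ → ‖h‖ < h₀ →
      ∫⁻ x in Metric.ball 0 R, ENNReal.ofReal (|diff h u x| ^ q) ≤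
        ENNReal.ofReal (‖h‖ ^ (α * q)) * (ENNReal.ofReal (K * h₀ ^ (-q)) *
          (secondDiffSup α q h₀ (R + 4 * h₀) u ^ q + 1)) := by
  have h2α : (2 : ℝ) ^ α < 2 := by
    calc (2 : ℝ) ^ α < 2 ^ (1 : ℝ) := Real.rpow_lt_rpow_of_exponent_lt (by norm_num) hα1
      _ = 2 := by norm_num
  have hκ : 0 < 1 / (2 - (2 : ℝ) ^ α) := one_div_pos.2 (by linarith)
  set κ := 1 / (2 - (2 : ℝ) ^ α) with hκd
  have hq0 : 0 < q := by linarith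
  set M : ℝ≥0∞ := volume (Metric.ball (0 : Euc N) 1) ^ (1 / q) * ENNReal.ofReal 6 with hM
  have hMtop : M ≠ ⊤ := ENNReal.mul_ne_top
    (ENNReal.rpow_ne_top_of_nonneg (by positivity) measure_ball_lt_top.ne) ENNReal.ofReal_ne_top
  refine ⟨2 ^ (q - 1) * (κ + 2 * M.toReal) ^ q, by positivity, ?_⟩
  intro h₀ R u h h0 h01 hR hu hu3 hh hh0
  set S := secondDiffSup α q h₀ (R + 4 * h₀) u with hS
  -- The crude bound that starts the doubling argument: first differences are at most 6 pointwise,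
  -- on a ball inside the unit ball.
  have hbound : ∀ k : Euc N, ‖k‖ < h₀ →
      eLpNorm (diff k u) (ENNReal.ofReal q) (volume.restrict (Metric.ball 0 R)) ≤ M := by
    intro k hk
    have hae : ∀ᵐ x ∂(volume.restrict (Metric.ball (0 : Euc N) R)), ‖diff k u x‖ ≤ 6 := by
      refine (ae_restrict_iff' Metric.isOpen_ball.measurableSet).2
        (Filter.Eventually.of_forall fun x hx => ?_)
      have hxR : ‖x‖ < R := by simpa using hx
      have h1 := hu3 x (by rw [mem_ball_zero_iff]; linarith)
      have h2 := hu3 (x + k) (by rw [mem_ball_zero_iff]; linarith [norm_add_le x k])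
      exact (abs_sub _ _).trans (by linarith)
    refine (eLpNorm_le_of_ae_bound hae).trans ?_
    rw [Measure.restrict_apply_univ, ENNReal.toReal_ofReal hq0.le, ← one_div, hM]
    refine mul_le_mul' (ENNReal.rpow_le_rpow ?_ (by positivity)) le_rfl
    exact measure_mono (Metric.ball_subset_ball (by linarith))
  have key := eLpNorm_diff_le_of_diff2 hu.aestronglyMeasurable (s := Metric.ball 0 R)
    (q := ENNReal.ofReal q) (by simpa using ENNReal.ofReal_le_ofReal hq) hα1 h0 h01
    (S := S) (M := M)
    (fun k hk hk0 => eLpNorm_diff2_le_secondDiffSup (by linarith) hk hk0) hbound hh hh0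
  rw [← hκd] at key
  have hlin : ENNReal.ofReal κ * S + ENNReal.ofReal (2 / h₀) * M ≤
      ENNReal.ofReal ((κ + 2 * M.toReal) / h₀) * (S + 1) := by
    have e1 : ENNReal.ofReal κ ≤ ENNReal.ofReal ((κ + 2 * M.toReal) / h₀) := by
      refine ENNReal.ofReal_le_ofReal ?_
      rw [le_div_iff₀ h0]
      have := ENNReal.toReal_nonneg (a := M)
      nlinarith
    have e2 : ENNReal.ofReal (2 / h₀) * M ≤ ENNReal.ofReal ((κ + 2 * M.toReal) / h₀) := by
      rw [← ENNReal.ofReal_toReal hMtop, ← ENNReal.ofReal_mul (by positivity),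
        ENNReal.toReal_ofReal ENNReal.toReal_nonneg]
      refine ENNReal.ofReal_le_ofReal ?_
      rw [div_mul_eq_mul_div]
      gcongr
      linarith
    rw [mul_add, mul_one]
    exact add_le_add (mul_le_mul' e1 le_rfl) e2
  rw [lintegral_abs_rpow_eq hq0]
  calc _ ≤ (ENNReal.ofReal (‖h‖ ^ α) * (ENNReal.ofReal ((κ + 2 * M.toReal) / h₀) * (S + 1))) ^ q :=
        ENNReal.rpow_le_rpow (key.trans (mul_le_mul' le_rfl hlin)) hq0.le
    _ = ENNReal.ofReal (‖h‖ ^ (α * q)) *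
          (ENNReal.ofReal (((κ + 2 * M.toReal) / h₀) ^ q) * (S + 1) ^ q) := by
        rw [ENNReal.mul_rpow_of_nonneg _ _ hq0.le, ENNReal.mul_rpow_of_nonneg _ _ hq0.le,
          ENNReal.ofReal_rpow_of_nonneg (by positivity) hq0.le,
          ENNReal.ofReal_rpow_of_nonneg (by positivity) hq0.le, ← Real.rpow_mul (norm_nonneg _)]
    _ ≤ ENNReal.ofReal (‖h‖ ^ (α * q)) * (ENNReal.ofReal (((κ + 2 * M.toReal) / h₀) ^ q) *
          (ENNReal.ofReal (2 ^ (q - 1)) * (S ^ q + 1))) := by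
        refine mul_le_mul' le_rfl (mul_le_mul' le_rfl ?_)
        have := ENNReal.rpow_add_le_mul_rpow_add_rpow S 1 hq
        rwa [ENNReal.one_rpow, ← ENNReal.ofReal_ofNat 2,
          ENNReal.ofReal_rpow_of_pos (by norm_num)] at this
    _ = _ := by
        rw [← mul_assoc (ENNReal.ofReal (((κ + 2 * M.toReal) / h₀) ^ q)),
          ← ENNReal.ofReal_mul (by positivity)]
        congr 3
        rw [Real.div_rpow (by positivity) h0.le, Real.rpow_neg h0.le]
        ring

theorem ofReal_mul_five {a b c d e : ℝ} (ha : 0 ≤ a) (hb : 0 ≤ b) (hc : 0 ≤ c) (hd : 0 ≤ d)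
    (S : ℝ≥0∞) :
    ENNReal.ofReal a * (ENNReal.ofReal b * (ENNReal.ofReal c *
      (ENNReal.ofReal d * (ENNReal.ofReal e * S)))) =
      ENNReal.ofReal (a * (b * (c * (d * e)))) * S := by
  rw [ENNReal.ofReal_mul ha, ENNReal.ofReal_mul hb, ENNReal.ofReal_mul hc, ENNReal.ofReal_mul hd]
  ring

theorem eLpNorm_div_rpow_eq {β Q r : ℝ} (hQ : 0 < Q) {h : Euc N} (hh : 0 < ‖h‖)
    (f : Euc N → ℝ) :
    eLpNorm (fun x => f x / ‖h‖ ^ β) (ENNReal.ofReal Q)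
        (volume.restrict (Metric.ball 0 r)) ^ Q =
      ENNReal.ofReal (‖h‖ ^ (-(β * Q))) *
        ∫⁻ x in Metric.ball 0 r, ENNReal.ofReal (|f x| ^ Q) := by
  rw [← lintegral_abs_rpow_eq hQ, ← lintegral_const_mul' _ _ ENNReal.ofReal_ne_top]
  refine lintegral_congr fun x => ?_
  have h1 : 0 < ‖h‖ ^ β := by positivity
  rw [← ENNReal.ofReal_mul (by positivity), abs_div, Real.div_rpow (abs_nonneg _) (abs_nonneg _),
    abs_of_pos h1, ← Real.rpow_mul hh.le, Real.rpow_neg hh.le]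
  congr 1; ring

end FracPLaplace

/-! ### Conclusion -/

theorem mainTheorem5 (N : ℕ) (hN : 1 ≤ N) (s p γ α q : ℝ)
    (hp : 1 < p ∧ p < 2) (hs : 0 < s ∧ s < 1) (hγ : 0 ≤ γ ∧ γ < 1)
    (hα : 0 ≤ α ∧ α < 1) (hq : 1 ≤ q) :
    ∃ C : ℝ → ℝ,
      (∀ h₀ ∈ Set.Ioo (0 : ℝ) (1 / 10), 0 < C h₀) ∧
      AntitoneOn C (Set.Ioo (0 : ℝ) (1 / 10)) ∧
      Tendsto C (𝓝[>] 0) atTop ∧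
      ∀ h₀ ∈ Set.Ioo (0 : ℝ) (1 / 10), ∀ R : ℝ, 4 * h₀ < R → R ≤ 1 - 5 * h₀ →
      ∀ u : EuclideanSpace ℝ (Fin N) → ℝ,
        FracPLaplace.IsLocalWeakSolution s p (Metric.ball 0 2) u →
        eLpNorm u ⊤ (volume.restrict (Metric.ball 0 1)) ≤ 1 →
        FracPLaplace.tail (p - 1) (s * p) u 0 1 ^ (p - 1) ≤ 1 →
        FracPLaplace.holderSeminorm γ (Metric.ball 0 1) u ≤ 1 →
        FracPLaplace.secondDiffSup α q h₀ (R + 4 * h₀) u < ⊤ →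
        FracPLaplace.secondDiffSup ((s * p - γ * (p - 2) + α * q) / (q + 1)) (q + 1) h₀
            (R - 4 * h₀) u ^ (q + 1) ≤
          ENNReal.ofReal (C h₀) *
            (FracPLaplace.secondDiffSup α q h₀ (R + 4 * h₀) u ^ q + 1) := by
  obtain ⟨K₁, hK₁, henergy⟩ := FracPLaplace.energy_diff_le hN hp.1 hp.2 hs.1 hs.2 hq γ
  obtain ⟨K₂, hK₂, hfirst⟩ := FracPLaplace.lintegral_diff_rpow_le hα.2 hq N
  set c : ℝ := 2 ^ (q + 1) * 2 * 2 ^ N /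
    (volume (Metric.ball (0 : FracPLaplace.Euc N) 1)).toReal with hc
  have hc0 : 0 < c := by
    have : 0 < (volume (Metric.ball (0 : FracPLaplace.Euc N) 1)).toReal :=
      ENNReal.toReal_pos (Metric.measure_ball_pos _ _ one_pos).ne' measure_ball_lt_top.ne
    positivity
  have hsp : 0 < s * p := mul_pos hs.1 (by linarith [hp.1])
  have hm : 0 < (N : ℝ) + s * p + p + q := by
    have : 0 < p := by linarith [hp.1]
    positivity
  -- The part `N + s p + p` is lost in the energy estimate with cutoff width `h₀`, and `q` in
  -- passing from first to second differences.
  set m : ℝ := (N : ℝ) + s * p + p + q with hmd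
  have hK : 0 < c * K₁ * K₂ := by positivity
  refine ⟨fun t => c * K₁ * K₂ * t ^ (-m), fun t ht => ?_, fun t ht t' _ htt' => ?_, ?_, ?_⟩
  · have := ht.1
    positivity
  · exact mul_le_mul_of_nonneg_left
      (Real.rpow_le_rpow_of_nonpos ht.1 htt' (by linarith)) hK.le
  · exact (tendsto_rpow_neg_nhdsGT_zero (by linarith)).const_mul_atTop hK
  intro h₀ hh₀ R hR hR1 u hsol hLinf htail hH _
  have h0 : 0 < h₀ := hh₀.1
  have h1 : h₀ < 1 / 10 := hh₀.2
  have hu := hsol.2.1.aemeasurable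
  have hu3 : ∀ x ∈ Metric.ball (0 : FracPLaplace.Euc N) 1, |u x| ≤ 3 := fun x hx =>
    FracPLaplace.abs_le_three hγ.1 hγ.2.le hLinf hH hx
  have hE : FracPLaplace.energy p (N + s * p) (Metric.ball 0 1) u < ⊤ := by
    have h2 := (hsol.1 (Metric.ball 0 1) Metric.isOpen_ball
      ((isCompact_closedBall (0 : FracPLaplace.Euc N) 1).of_isClosed_subset isClosed_closure
        Metric.closure_ball_subset_closedBall)
      (Metric.closure_ball_subset_closedBall.trans
        (Metric.closedBall_subset_ball (by norm_num)))).2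
    rw [FracPLaplace.gagliardoSeminorm,
      ENNReal.rpow_lt_top_iff_of_pos (by have := hp.1; positivity)] at h2
    exact h2
  have htail' : ∫⁻ x in (Metric.ball (0 : FracPLaplace.Euc N) 1)ᶜ,
      ENNReal.ofReal (|u x| ^ (p - 1) / ‖x‖ ^ ((N : ℝ) + s * p)) ≤ 1 := by
    have hp1 : p - 1 ≠ 0 := by linarith [hp.1]
    rw [FracPLaplace.tail, ← ENNReal.rpow_mul, one_div_mul_cancel hp1, ENNReal.rpow_one,
      Real.one_rpow, ENNReal.ofReal_one, one_mul] at htail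
    simpa only [sub_zero] using htail
  have hq1 : 0 < q + 1 := by linarith
  rw [← ENNReal.le_rpow_inv_iff hq1]
  refine iSup₂_le fun h hh => ?_
  rw [ENNReal.le_rpow_inv_iff hq1, FracPLaplace.eLpNorm_div_rpow_eq hq1 hh.1,
    div_mul_cancel₀ _ hq1.ne']
  have hσ : 0 ≤ s * p - γ * (p - 2) := by nlinarith [hp.2, hγ.1]
  set σ := s * p - γ * (p - 2) with hσd
  have hhne : h ≠ 0 := norm_pos_iff.1 hh.1
  have hRh : R + ‖h‖ ≤ 1 := by linarith [hh.2]
  -- The increment of `δ_h u` by the same `h` is `δ_h² u`. Since `‖h‖ < h₀`, enlarging the radius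
  -- from `R - 4 h₀` to `R - 3 h₀` makes room for the shift, and `R - 3 h₀` is what the energy
  -- estimate with `d = h₀` provides.
  have e1 := FracPLaplace.lintegral_increment_le (w := FracPLaplace.diff h u) (Q := q + 1)
    (σ := σ) (r := R - 4 * h₀) (ρ := R - 3 * h₀)
    ((hu.comp_quasiMeasurePreserving
      (measurePreserving_add_right volume h).quasiMeasurePreserving).sub hu) hq1 (by positivity)
    hhne (by linarith [hh.2])
  have e2 := henergy h₀ R u h h0 (by linarith) hRh hu hsol hu3
    (fun x hx y hy => FracPLaplace.abs_sub_le_of_holderSeminorm_le hH hx hy) htail' hE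
  have e3 := hfirst h₀ R u h h0 (by linarith) (by linarith) hu hu3 hh.1 hh.2
  set S := FracPLaplace.secondDiffSup α q h₀ (R + 4 * h₀) u ^ q + 1 with hS
  rw [← hc] at e1
  have hhp := hh.1
  calc _ ≤ ENNReal.ofReal (‖h‖ ^ (-(σ + α * q))) * (ENNReal.ofReal (c * ‖h‖ ^ σ) *
        (ENNReal.ofReal (K₁ * h₀ ^ (-((N : ℝ) + s * p + p))) *
          (ENNReal.ofReal (‖h‖ ^ (α * q)) * (ENNReal.ofReal (K₂ * h₀ ^ (-q)) * S)))) :=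
        mul_le_mul' le_rfl (e1.trans (mul_le_mul' le_rfl (e2.trans (mul_le_mul' le_rfl e3))))
    _ = ENNReal.ofReal (‖h‖ ^ (-(σ + α * q)) * (c * ‖h‖ ^ σ * (K₁ * h₀ ^ (-((N : ℝ) + s * p + p)) *
          (‖h‖ ^ (α * q) * (K₂ * h₀ ^ (-q)))))) * S := by
        refine FracPLaplace.ofReal_mul_five ?_ ?_ ?_ ?_ S <;> positivity
    _ = _ := by
        congr 2
        -- The normalisation is balanced exactly by the gain `σ` from the energy and the gain `α q`
        -- from the first differences, so the bound is uniform in `h`.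
        have e4 : ‖h‖ ^ (-(σ + α * q)) * ‖h‖ ^ σ * ‖h‖ ^ (α * q) = 1 := by
          rw [← Real.rpow_add hhp, ← Real.rpow_add hhp]
          rw [show -(σ + α * q) + σ + α * q = 0 by ring, Real.rpow_zero]
        have e5 : h₀ ^ (-((N : ℝ) + s * p + p)) * h₀ ^ (-q) = h₀ ^ (-m) := by
          rw [← Real.rpow_add h0, hmd]; congr 1; ring
        calc _ = c * K₁ * K₂ * (h₀ ^ (-((N : ℝ) + s * p + p)) * h₀ ^ (-q)) *
              (‖h‖ ^ (-(σ + α * q)) * ‖h‖ ^ σ * ‖h‖ ^ (α * q)) := by ring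
          _ = _ := by rw [e4, e5, mul_one]
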